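/- **Setting.** Let $T>0$ and let $m,n\ge 1$ be integers. For a function $f$ on $[0,T]$ put $\delta f_{s,t}=f_t-f_s$ and $\|f\|_\infty=\sup_{t\in[0,T]}|f_t|$. For a function $R$ on $[0,T]^2$ put $\|R\|_{\alpha}=\sup_{s\ne t}|R_{s,t}|/|t-s|^{\alpha}$, and write $\|f\|_\gamma=\|\delta f\|_\gamma$, $\|f\|_{\mathcal C^\gamma}=\|f\|_\infty+\|f\|_\gamma$. The space $\mathcal C^\gamma$ consists of the continuous $f$ with $\|f\|_\gamma<\infty$. A $\gamma$-Hölder rough path $(X,\mathbb X)$ on $[0,T]$ in $\mathbb R^n$ consists of continuous maps $X:[0,T]\to\mathbb R^n$ and $\mathbb X:[0,T]^2\to\mathbb R^{n\times n}$, the latter vanishing on the diagonal, such that $$\mathbb X^{ij}_{st}-\mathbb X^{ij}_{ut}-\mathbb X^{ij}_{su}=\delta X^i_{su}\,\delta X^j_{ut}\qquad (s,u,t\in[0,T],\ 1\le i,j\le n)$$ and $\|(X,\mathbb X)\|_\gamma=\|X\|_\gamma+\|\mathbb X\|_{2\gamma}<\infty$. For $\theta\in(0,1)$, the path $X$ is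 $\theta$-Hölder rough if there is $L>0$ such that for all $s\in[0,T]$, $\varepsilon\in(0,T/2]$ and $\phi\in\mathbb R^n$ with $|\phi|=1$ there is $t\in[0,T]$ with $\varepsilon/2<|t-s|<\varepsilon$ and $|\langle\phi,\delta X_{s,t}\rangle|>L\varepsilon^\theta$. The supremum of such $L$ is denoted $L_\theta(X)$. A pair $(A,A')$ with $A\in\mathcal C^\gamma([0,T],\mathbb R^{m\times n})$ and $A'\in\mathcal C^\gamma([0,T],\mathcal L(\mathbb R^n,\mathbb R^{m\times n}))$ is controlled by $X$ if the remainder $R^A_{s,t}=\delta A_{s,t}-A'_s\,\delta X_{s,t}$ satisfies $\|R^A\|_{2\gamma}<\infty$; then $\|(A,A')\|_{X,\gamma}=|A_0|+\|A'\|_{\mathcal C^\gamma}+\|R^A\|_{2\gamma}$. Writing $A'_s x=\sum_k x_k A'_{s,k}$ with $A'_{s,k}\in\mathbb R^{m\times n}$, the rough integral is $$\int_0^tA_s\,dX_s=\lim_{|P|\to0}\sum_{[u,v]\in P}\Bigl(A_u\,\delta X_{u,v}+\sum_{k,j=1}^n\mathbb X^{kj}_{u,v}\,A'_{u,k}e_j\Bigr)\in\mathbb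 R^m,$$ where $P$ runs over the finite partitions of $[0,t]$ into subintervals, $|P|$ is the length of the longest subinterval, and $(e_j)$ is the standard basis of $\mathbb R^n$. Here $\mathbb{R}^n$, $\mathbb{R}^m$ and $\mathbb{R}^{n\times n}$ carry Euclidean norms, and the spaces of linear maps (with $\mathbb R^{m\times n}$ identified with $\mathcal L(\mathbb R^n,\mathbb R^m)$) carry operator norms. **Theorem.** Let $\gamma>\frac13$, $\theta\in(0,1)$ and $\theta<2\gamma$. There is an exponent $r=r(\gamma,\theta)>0$, depending only on $\gamma$ and $\theta$, and for each $T,m,n$ there is a constant $M>0$, depending only on $T$, $m$ and $n$, such that the following holds. Let $(X,\mathbb X)$ be a $\gamma$-Hölder rough path in $\mathbb R^n$ on $[0,T]$ such that $X$ is $\theta$-Hölder rough, let $(A,A')$ be controlled by $X$ as above, and let $B\in\mathcal C^\gamma([0,T],\mathbb R^m)$. Then the limit defining $\int_0^tA_s\,dX_s$ exists for every $t\in[0,T]$, and with $$Z_t=\int_0^tA_s\,dX_s+\int_0^tB_s\,ds,\qquad \mathcal R=1+L_\theta(X)^{-1}+\|(X,\mathbb X)\|_\gamma+\|(A,A')\|_{X,\gamma}+\|B\|_{\mathcal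 C^\gamma},$$ one has $$\|A\|_\infty+\|B\|_\infty\le M\,\mathcal R^{6}\,\|Z\|_\infty^{r},$$ with strict inequality whenever $\|Z\|_\infty>0$. -/

import Mathlib

open Set Filter Topology

noncomputable section

namespace NorrisRP

/-- The Euclidean space `ℝⁿ`. -/
abbrev Vec (n : ℕ) : Type := EuclideanSpace ℝ (Fin n)

/-- `ℝ^{n × n}` with the Euclidean (Frobenius) norm: the values of an area process. -/
abbrev Area (n : ℕ) : Type := EuclideanSpace ℝ (Fin n × Fin n)

/-! ### Norms of functions on `[0, T]` (functions are total; only their values on `[0, T]` matter) -/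

section Norms

variable {F : Type*} [NormedAddCommGroup F]

/-- The increment `δf_{s,t} = f t - f s`. -/
def incr (f : ℝ → F) (s t : ℝ) : F := f t - f s

/-- The supremum norm of `f` over `[0, T]`. -/
def supNorm (T : ℝ) (f : ℝ → F) : ℝ := sSup ((fun t => ‖f t‖) '' Icc 0 T)

/-- All the quotients `|R_{s,t}| / |t - s|^α` with `s ≠ t` in `[0, T]`. -/
def holderQuotients (T α : ℝ) (R : ℝ → ℝ → F) : Set ℝ :=
  {q | ∃ s ∈ Icc 0 T, ∃ t ∈ Icc 0 T, s ≠ t ∧ q = ‖R s t‖ / |t - s| ^ α}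

/-- The two-parameter function `R` satisfies `‖R‖_α < ∞`. -/
def FiniteHolder (T α : ℝ) (R : ℝ → ℝ → F) : Prop := BddAbove (holderQuotients T α R)

/-- `‖R‖_α`, the supremum of `|R_{s,t}| / |t - s|^α`; meaningful when `FiniteHolder T α R`. -/
def holderSeminorm (T α : ℝ) (R : ℝ → ℝ → F) : ℝ := sSup (holderQuotients T α R)

/-- `f ∈ C^γ([0, T], F)`. -/
structure IsHolderPath (T γ : ℝ) (f : ℝ → F) : Prop where
  continuousOn : ContinuousOn f (Icc 0 T)
  finite : FiniteHolder T γ (incr f)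

/-- The norm `‖f‖_∞ + ‖f‖_γ` on `C^γ([0, T], F)`. -/
def holderNorm (T γ : ℝ) (f : ℝ → F) : ℝ := supNorm T f + holderSeminorm T γ (incr f)

end Norms

/-! ### Rough paths -/

/-- `(X, 𝕏)` belongs to the space `D^γ([0, T], ℝⁿ)` of `γ`-Hölder rough paths; the entry
`𝕏_{s,t} (i, j)` plays the role of `∫ δX^i_{s,r} dX^j_r`. -/
structure IsRoughPath {n : ℕ} (T γ : ℝ) (X : ℝ → Vec n) (XX : ℝ → ℝ → Area n) : Prop where
  continuousOn_path : ContinuousOn X (Icc 0 T)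
  continuousOn_area : ContinuousOn (fun p : ℝ × ℝ => XX p.1 p.2) (Icc 0 T ×ˢ Icc 0 T)
  area_diag : ∀ s ∈ Icc 0 T, XX s s = 0
  chen : ∀ s ∈ Icc 0 T, ∀ u ∈ Icc 0 T, ∀ t ∈ Icc 0 T, ∀ i j : Fin n,
    XX s t (i, j) - XX u t (i, j) - XX s u (i, j) = incr X s u i * incr X u t j
  finite_path : FiniteHolder T γ (incr X)
  finite_area : FiniteHolder T (2 * γ) XX

/-- `‖(X, 𝕏)‖_γ = ‖X‖_γ + ‖𝕏‖_{2γ}`. -/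
def roughPathNorm {n : ℕ} (T γ : ℝ) (X : ℝ → Vec n) (XX : ℝ → ℝ → Area n) : ℝ :=
  holderSeminorm T γ (incr X) + holderSeminorm T (2 * γ) XX

/-- The defining property of the constant `L` in the notion of `θ`-Hölder roughness on `[0, T]`. -/
def RoughWith {n : ℕ} (T θ : ℝ) (X : ℝ → Vec n) (L : ℝ) : Prop :=
  ∀ s ∈ Icc 0 T, ∀ ε ∈ Ioc 0 (T / 2), ∀ φ : Vec n, ‖φ‖ = 1 →
    ∃ t ∈ Icc 0 T, ε / 2 < |t - s| ∧ |t - s| < ε ∧ L * ε ^ θ < |inner ℝ φ (incr X s t)|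

/-- `X` is `θ`-Hölder rough on `[0, T]`: it is rough with some positive constant. -/
def IsHolderRough {n : ℕ} (T θ : ℝ) (X : ℝ → Vec n) : Prop := ∃ L : ℝ, 0 < L ∧ RoughWith T θ X L

/-- The modulus of `θ`-Hölder roughness `L_θ(X)`: the supremum of the admissible constants. -/
def roughModulus {n : ℕ} (T θ : ℝ) (X : ℝ → Vec n) : ℝ := sSup {L : ℝ | 0 < L ∧ RoughWith T θ X L}

/-! ### Controlled paths -/

section Controlled

variable {n : ℕ} {F : Type*} [NormedAddCommGroup F] [NormedSpace ℝ F]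

/-- The remainder `R^Z_{s,t} = δZ_{s,t} - Z'_s δX_{s,t}`. -/
def remainder (X : ℝ → Vec n) (Z : ℝ → F) (Z' : ℝ → Vec n →L[ℝ] F) (s t : ℝ) : F :=
  incr Z s t - Z' s (incr X s t)

/-- `(Z, Z')` is an `F`-valued path controlled by `X`. -/
structure IsControlled (T γ : ℝ) (X : ℝ → Vec n) (Z : ℝ → F) (Z' : ℝ → Vec n →L[ℝ] F) :
    Prop where
  path : IsHolderPath T γ Z
  deriv : IsHolderPath T γ Z'
  finite_remainder : FiniteHolder T (2 * γ) (remainder X Z Z')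

/-- `‖(Z, Z')‖_{X,γ} = |Z_0| + ‖Z'‖_∞ + ‖Z'‖_γ + ‖R^Z‖_{2γ}`. -/
def controlledNorm (T γ : ℝ) (X : ℝ → Vec n) (Z : ℝ → F) (Z' : ℝ → Vec n →L[ℝ] F) : ℝ :=
  ‖Z 0‖ + holderNorm T γ Z' + holderSeminorm T (2 * γ) (remainder X Z Z')

end Controlled

/-! ### The rough integral -/

/-- A finite partition `a = p_0 < p_1 < ... < p_N = b` of `[a, b]`
(the values `pts i` for `i > N` are irrelevant). -/
structure IntervalPartition (a b : ℝ) where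
  /-- The number of subintervals. -/
  N : ℕ
  /-- The partition points. -/
  pts : ℕ → ℝ
  left : pts 0 = a
  right : pts N = b
  strict : ∀ i < N, pts i < pts (i + 1)

/-- The length of the longest subinterval of a partition. -/
def IntervalPartition.mesh {a b : ℝ} (P : IntervalPartition a b) : ℝ :=
  ⨆ i : Fin P.N, (P.pts (i + 1) - P.pts i)

/-- The filter on partitions of `[a, b]` describing the limit `|P| → 0`. -/
def meshFilter (a b : ℝ) : Filter (IntervalPartition a b) :=
  comap IntervalPartition.mesh (𝓝 0)

section Integral

variable {n m : ℕ}

/-- The contraction `∑_{k,j} 𝕏^{kj} A'_k e_j`, where `A'_k` (a linear map `ℝⁿ → ℝᵐ`) is the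
derivative of `A` in the direction of the `k`-th coordinate of `X`. -/
def areaTerm (A' : Vec n →L[ℝ] Vec n →L[ℝ] Vec m) (x : Area n) : Vec m :=
  ∑ k : Fin n, ∑ j : Fin n,
    x (k, j) • A' (EuclideanSpace.single k 1) (EuclideanSpace.single j 1)

/-- The compensated Riemann sum of the controlled path `(A, A')` along a partition. -/
def riemannSum (X : ℝ → Vec n) (XX : ℝ → ℝ → Area n) (A : ℝ → Vec n →L[ℝ] Vec m)
    (A' : ℝ → Vec n →L[ℝ] Vec n →L[ℝ] Vec m) {a b : ℝ} (P : IntervalPartition a b) : Vec m :=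
  ∑ i ∈ Finset.range P.N,
    (A (P.pts i) (incr X (P.pts i) (P.pts (i + 1)))
      + areaTerm (A' (P.pts i)) (XX (P.pts i) (P.pts (i + 1))))

/-- The rough integral `∫_0^t A_s dX_s`: the limit of the compensated Riemann sums over partitions
of `[0, t]` as the mesh tends to zero. -/
def roughIntegral (X : ℝ → Vec n) (XX : ℝ → ℝ → Area n) (A : ℝ → Vec n →L[ℝ] Vec m)
    (A' : ℝ → Vec n →L[ℝ] Vec n →L[ℝ] Vec m) (t : ℝ) : Vec m :=
  limUnder (meshFilter 0 t) (fun P => riemannSum X XX A A' P)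

/-- The path `Z_t = ∫_0^t A_s dX_s + ∫_0^t B_s ds`. -/
def integralPath (X : ℝ → Vec n) (XX : ℝ → ℝ → Area n) (A : ℝ → Vec n →L[ℝ] Vec m)
    (A' : ℝ → Vec n →L[ℝ] Vec n →L[ℝ] Vec m) (B : ℝ → Vec m) (t : ℝ) : Vec m :=
  roughIntegral X XX A A' t + ∫ s in (0 : ℝ)..t, B s

/-- The quantity `1 + L_θ(X)⁻¹ + ‖(X, 𝕏)‖_γ + ‖(A, A')‖_{X,γ} + ‖B‖_{C^γ}`. -/
def norrisR (T γ θ : ℝ) (X : ℝ → Vec n) (XX : ℝ → ℝ → Area n) (A : ℝ → Vec n →L[ℝ] Vec m)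
    (A' : ℝ → Vec n →L[ℝ] Vec n →L[ℝ] Vec m) (B : ℝ → Vec m) : ℝ :=
  1 + (roughModulus T θ X)⁻¹ + roughPathNorm T γ X XX + controlledNorm T γ X A A'
    + holderNorm T γ B

end Integral

end NorrisRP

end

/-! On short intervals `Z` expands as `A_s δX_{s,t} + 𝕏_{s,t} A'_s + (t - s) B_s`, with errors of
order `3γ` and `1 + γ`, both above 1. The rough part of the expansion comes from the sewing lemma
(`IsSewable.exists_integral`): Chen's relation makes the germ additive up to order `3γ`
(`germ_defect`). The same lemma gives convergence of the Riemann sums.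

Suppose `‖Z‖_∞ ≤ z ≤ 1`. The expansion bounds `A_s δX_{s,t}` by `z + ε ^ min(2γ, 1)` up to constants
when `|t - s| ≤ ε`, while roughness provides a `t` at which the increment detects `‖A_s‖ ε ^ θ`.
Since `θ < min(2γ, 1)`, optimising over `ε` bounds `A` by a power of `z` (`norm_le_of_rough`). The
controlled expansion `A'_s δX = δA - R^A` has the same shape with `A` in the role of `Z`, so the
same argument bounds `A'`. Once `A` and `A'` are small, the expansion of `Z` isolates `|t - s|
‖B_s‖` up to an order above 1, and choosing `|t - s| = ε` bounds `B` without roughness.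

This yields `C(γ) Q ^ 10 z ^ q`, where `Q` is `norrisR` times a factor depending on `T` and `n`. The
constant `C(γ)` blows up as `γ ↓ 1/3`, and the power of `Q` is too large. Both defects are removed
by interpolating with the a priori bound `4 Q ^ 3`: raising the estimate to a small power `l(γ)`
leaves `12 Q ^ 4`, at the price of the smaller exponent `r = q l`. -/

noncomputable section

namespace NorrisRP

/-! ### Sewing lemma along dyadic subdivisions. -/

section Sewing

variable {V : Type*} [NormedAddCommGroup V]

/-- The germ `Ξ` is sewable on `[0, T]`: it vanishes on the diagonal and its defect of additivity
is of order `a`. -/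
structure IsSewable (T K a : ℝ) (Ξ : ℝ → ℝ → V) : Prop where
  diag : ∀ s ∈ Icc 0 T, Ξ s s = 0
  defect : ∀ s ∈ Icc 0 T, ∀ u ∈ Icc 0 T, ∀ t ∈ Icc 0 T, ∀ h : ℝ, |u - s| ≤ h → |t - u| ≤ h →
    ‖Ξ s t - Ξ s u - Ξ u t‖ ≤ K * h ^ a

theorem two_mul_half_rpow_lt_one {a : ℝ} (ha : 1 < a) : 2 * (1 / 2 : ℝ) ^ a < 1 := by
  have h := Real.rpow_lt_rpow_of_exponent_gt (x := 1 / 2) (by norm_num) (by norm_num) ha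
  rw [Real.rpow_one] at h
  linarith

/-- The constant of the sewing lemma. -/
def sewingConst (K a : ℝ) : ℝ := 2 * K / (1 - 2 * (1 / 2 : ℝ) ^ a)

theorem sewingConst_nonneg {K a : ℝ} (hK : 0 ≤ K) (ha : 1 < a) : 0 ≤ sewingConst K a :=
  div_nonneg (by linarith) (by linarith [two_mul_half_rpow_lt_one ha])

/-- Strong induction on the number of cells. The cell straddling the midpoint in length is cut out;
the blocks on its two sides have at most half the length, and reassembling the three pieces costs
two defects. The bound does not depend on the number of points. -/
theorem IsSewable.norm_sum_sub_le {T K a : ℝ} {Ξ : ℝ → ℝ → V} (hΞ : IsSewable T K a Ξ)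
    (hK : 0 ≤ K) (ha : 1 < a) {p : ℕ → ℝ} (hp : Monotone p) (hmem : ∀ i, p i ∈ Icc 0 T) (d : ℕ) :
    ∀ i, ‖∑ k ∈ Finset.range d, Ξ (p (i + k)) (p (i + k + 1)) - Ξ (p i) (p (i + d))‖
      ≤ sewingConst K a * (p (i + d) - p i) ^ a := by
  induction d using Nat.strong_induction_on with
  | _ d ih =>
  intro i
  have hC := sewingConst_nonneg hK ha
  have ha0 : a ≠ 0 := by linarith
  obtain _ | d := d
  · simp [hΞ.diag _ (hmem i), Real.zero_rpow ha0]
  set mid := (p i + p (i + (d + 1))) / 2 with hmid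
  have hle : p i ≤ p (i + (d + 1)) := hp (by omega)
  -- The search stops at `d`, not `d + 1`, so that the straddling cell from `i + k` to `i + k + 1`
  -- always exists.
  set k := Nat.findGreatest (fun k => p (i + k) ≤ mid) d with hk
  have hkd : k ≤ d := Nat.findGreatest_le d
  have h1 : p (i + k) ≤ mid :=
    Nat.findGreatest_spec (P := fun k => p (i + k) ≤ mid) (Nat.zero_le d)
      (by simp only [add_zero]; linarith)
  have h2 : mid ≤ p (i + k + 1) := by
    by_cases h : k + 1 ≤ d
    · have := Nat.findGreatest_is_greatest (P := fun k => p (i + k) ≤ mid) (Nat.lt_succ_self k) h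
      exact (not_le.1 this).le
    · have : i + k + 1 = i + (d + 1) := by omega
      rw [this]; linarith
  have e1 := ih k (by omega) i
  have e2 := ih (d - k) (by omega) (i + k + 1)
  have hend : i + k + 1 + (d - k) = i + (d + 1) := by omega
  rw [hend] at e2
  set h := p (i + (d + 1)) - p i with hh
  have hh0 : 0 ≤ h := by linarith
  have m1 : p i ≤ p (i + k) := hp (by omega)
  have m2 : p (i + k) ≤ p (i + k + 1) := hp (by omega)
  have m3 : p (i + k + 1) ≤ p (i + (d + 1)) := hp (by omega)
  have d1 := hΞ.defect _ (hmem i) _ (hmem (i + k + 1)) _ (hmem (i + (d + 1))) h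
    (by rw [abs_of_nonneg] <;> linarith) (by rw [abs_of_nonneg] <;> linarith)
  have d2 := hΞ.defect _ (hmem i) _ (hmem (i + k)) _ (hmem (i + k + 1)) h
    (by rw [abs_of_nonneg] <;> linarith) (by rw [abs_of_nonneg] <;> linarith)
  have b1 : (p (i + k) - p i) ^ a ≤ (1 / 2 : ℝ) ^ a * h ^ a := by
    rw [← Real.mul_rpow (by norm_num) hh0]
    exact Real.rpow_le_rpow (by linarith) (by linarith) (by linarith)
  have b2 : (p (i + (d + 1)) - p (i + k + 1)) ^ a ≤ (1 / 2 : ℝ) ^ a * h ^ a := by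
    rw [← Real.mul_rpow (by norm_num) hh0]
    exact Real.rpow_le_rpow (by linarith) (by linarith) (by linarith)
  have hsum : ∑ l ∈ Finset.range (d + 1), Ξ (p (i + l)) (p (i + l + 1))
      = ∑ l ∈ Finset.range k, Ξ (p (i + l)) (p (i + l + 1)) + Ξ (p (i + k)) (p (i + k + 1))
        + ∑ l ∈ Finset.range (d - k), Ξ (p (i + k + 1 + l)) (p (i + k + 1 + l + 1)) := by
    have : d + 1 = k + 1 + (d - k) := by omega
    rw [this, Finset.sum_range_add, Finset.sum_range_succ]
    simp only [add_assoc]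
  have hdec : ∑ l ∈ Finset.range (d + 1), Ξ (p (i + l)) (p (i + l + 1)) - Ξ (p i) (p (i + (d + 1)))
      = (∑ l ∈ Finset.range k, Ξ (p (i + l)) (p (i + l + 1)) - Ξ (p i) (p (i + k)))
        + (∑ l ∈ Finset.range (d - k), Ξ (p (i + k + 1 + l)) (p (i + k + 1 + l + 1))
          - Ξ (p (i + k + 1)) (p (i + (d + 1))))
        - (Ξ (p i) (p (i + (d + 1))) - Ξ (p i) (p (i + k + 1))
          - Ξ (p (i + k + 1)) (p (i + (d + 1))))
        - (Ξ (p i) (p (i + k + 1)) - Ξ (p i) (p (i + k)) - Ξ (p (i + k)) (p (i + k + 1))) := by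
    rw [hsum]; abel
  have hne : 1 - 2 * (1 / 2 : ℝ) ^ a ≠ 0 := by linarith [two_mul_half_rpow_lt_one ha]
  have hCeq : 2 * K + sewingConst K a * (2 * (1 / 2 : ℝ) ^ a) = sewingConst K a := by
    unfold sewingConst; field_simp; ring
  rw [hdec]
  calc _ ≤ sewingConst K a * ((1 / 2 : ℝ) ^ a * h ^ a)
        + sewingConst K a * ((1 / 2 : ℝ) ^ a * h ^ a) + K * h ^ a + K * h ^ a := by
        refine (norm_sub_le _ _).trans (add_le_add ((norm_sub_le _ _).trans (add_le_add
          ((norm_add_le _ _).trans (add_le_add (e1.trans ?_) (e2.trans ?_))) d1)) d2)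
        · exact mul_le_mul_of_nonneg_left b1 hC
        · exact mul_le_mul_of_nonneg_left b2 hC
    _ = (2 * K + sewingConst K a * (2 * (1 / 2 : ℝ) ^ a)) * h ^ a := by ring
    _ = sewingConst K a * h ^ a := by rw [hCeq]

/-- The points of the dyadic subdivision of `[0, T]`. -/
def dyadicPoint (T : ℝ) (N k : ℕ) : ℝ := k * (T / 2 ^ N)

theorem dyadicPoint_zero (T : ℝ) (N : ℕ) : dyadicPoint T N 0 = 0 := by simp [dyadicPoint]

theorem dyadicPoint_last (T : ℝ) (N : ℕ) : dyadicPoint T N (2 ^ N) = T := by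
  simp only [dyadicPoint]; push_cast; field_simp

theorem dyadicPoint_succ_sub (T : ℝ) (N k : ℕ) :
    dyadicPoint T N (k + 1) - dyadicPoint T N k = T / 2 ^ N := by
  simp only [dyadicPoint]; push_cast; ring

theorem dyadicPoint_refine (T : ℝ) (N k : ℕ) :
    dyadicPoint T (N + 1) (2 * k) = dyadicPoint T N k := by
  simp only [dyadicPoint, pow_succ]; push_cast; field_simp

theorem dyadicPoint_mono {T : ℝ} (hT : 0 ≤ T) (N : ℕ) : Monotone (dyadicPoint T N) := by
  intro i j hij
  exact mul_le_mul_of_nonneg_right (by exact_mod_cast hij) (by positivity)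

theorem dyadicPoint_nonneg {T : ℝ} (hT : 0 ≤ T) (N k : ℕ) : 0 ≤ dyadicPoint T N k := by
  unfold dyadicPoint; positivity

/-- The Riemann sum of the germ `Ξ` along the dyadic subdivision stopped at `t`. -/
def dyadicSum (Ξ : ℝ → ℝ → V) (T : ℝ) (N : ℕ) (t : ℝ) : V :=
  ∑ k ∈ Finset.range (2 ^ N), Ξ (min (dyadicPoint T N k) t) (min (dyadicPoint T N (k + 1)) t)

theorem sum_range_two_mul (f : ℕ → V) (M : ℕ) :
    ∑ k ∈ Finset.range (2 * M), f k = ∑ k ∈ Finset.range M, (f (2 * k) + f (2 * k + 1)) := by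
  induction M with
  | zero => simp
  | succ M ih => rw [mul_add, mul_one, Finset.sum_range_succ, Finset.sum_range_succ, ih,
      Finset.sum_range_succ, add_assoc]

theorem dyadic_defect_eq {T K a : ℝ} (hT : 0 ≤ T) (N : ℕ) :
    (2 ^ N : ℝ) * (K * (T / 2 ^ N) ^ a) = K * T ^ a * (2 * (1 / 2 : ℝ) ^ a) ^ N := by
  have : (T / 2 ^ N) ^ a = T ^ a * ((1 / 2 : ℝ) ^ a) ^ N := by
    rw [← Real.rpow_natCast ((1 / 2 : ℝ) ^ a), ← Real.rpow_mul (by norm_num), mul_comm a,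
      Real.rpow_mul (by norm_num), ← Real.mul_rpow hT (by positivity), Real.rpow_natCast]
    congr 1
    rw [div_pow, one_pow]; ring
  rw [this, mul_pow]; ring

theorem IsSewable.dist_dyadicSum_succ_le {T K a : ℝ} {Ξ : ℝ → ℝ → V} (hΞ : IsSewable T K a Ξ)
    (hT : 0 ≤ T) (hK : 0 ≤ K) (ha : 1 < a) {t : ℝ} (ht : t ∈ Icc 0 T) (N : ℕ) :
    dist (dyadicSum Ξ T N t) (dyadicSum Ξ T (N + 1) t)
      ≤ K * T ^ a * (2 * (1 / 2 : ℝ) ^ a) ^ N := by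
  have hmem : ∀ N k, min (dyadicPoint T N k) t ∈ Icc 0 T := fun N k =>
    ⟨le_min (dyadicPoint_nonneg hT _ _) ht.1, (min_le_right _ _).trans ht.2⟩
  have hstep : ∀ M k, |min (dyadicPoint T M (k + 1)) t - min (dyadicPoint T M k) t|
      ≤ T / 2 ^ M := fun M k => by
    refine (abs_min_sub_min_le_max _ _ _ _).trans ?_
    rw [dyadicPoint_succ_sub, sub_self, abs_zero, abs_of_nonneg (by positivity)]
    exact max_le le_rfl (by positivity)
  rw [dist_eq_norm, dyadicSum, dyadicSum, pow_succ', sum_range_two_mul, ← Finset.sum_sub_distrib,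
    ← dyadic_defect_eq hT]
  refine (norm_sum_le_of_le _ (n := fun _ => K * (T / 2 ^ N) ^ a) fun k _ => ?_).trans (by simp)
  have hk : 2 * k + 1 + 1 = 2 * (k + 1) := by ring
  have key := hΞ.defect _ (hmem (N + 1) (2 * k)) _ (hmem (N + 1) (2 * k + 1)) _
    (hmem (N + 1) (2 * k + 1 + 1)) _ (hstep (N + 1) (2 * k)) (hstep (N + 1) (2 * k + 1))
  rw [hk, dyadicPoint_refine, dyadicPoint_refine] at key ⊢
  rw [← sub_sub]
  refine key.trans (mul_le_mul_of_nonneg_left (Real.rpow_le_rpow (by positivity) ?_ (by linarith)) hK)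
  gcongr <;> norm_num

/-- Cells on either side of `s` match exactly; a cell containing `s` costs one defect. Charging a
defect to every cell is wasteful but still decays geometrically. -/
theorem IsSewable.norm_dyadicSum_sub_sub_le {T K a : ℝ} {Ξ : ℝ → ℝ → V} (hΞ : IsSewable T K a Ξ)
    (hT : 0 ≤ T) (hK : 0 ≤ K) {s t : ℝ} (hs : s ∈ Icc 0 T) (ht : t ∈ Icc 0 T)
    (hst : s ≤ t) (N : ℕ) :
    ‖dyadicSum Ξ T N t - dyadicSum Ξ T N s - ∑ k ∈ Finset.range (2 ^ N),
        Ξ (max s (min (dyadicPoint T N k) t)) (max s (min (dyadicPoint T N (k + 1)) t))‖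
      ≤ K * T ^ a * (2 * (1 / 2 : ℝ) ^ a) ^ N := by
  rw [← dyadic_defect_eq hT, dyadicSum, dyadicSum, ← Finset.sum_sub_distrib,
    ← Finset.sum_sub_distrib]
  refine (norm_sum_le_of_le _ (n := fun _ => K * (T / 2 ^ N) ^ a) fun k _ => ?_).trans (by simp)
  have hxy := dyadicPoint_succ_sub T N k
  have hx0 := dyadicPoint_nonneg hT N k
  have hh : 0 ≤ T / 2 ^ N := by positivity
  set x := dyadicPoint T N k
  set y := dyadicPoint T N (k + 1)
  have hpos : 0 ≤ K * (T / 2 ^ N) ^ a := by positivity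
  rcases le_total y s with hys | hys
  · rw [min_eq_left (by linarith : x ≤ t), min_eq_left (by linarith : y ≤ t),
      min_eq_left (by linarith : x ≤ s), min_eq_left hys, max_eq_left (by linarith : x ≤ s),
      max_eq_left hys, hΞ.diag s hs]
    simpa using hpos
  rcases le_total s x with hsx | hsx
  · rw [min_eq_right hsx, min_eq_right hys, hΞ.diag s hs, max_eq_right (le_min hsx hst),
      max_eq_right (le_min hys hst)]
    simpa using hpos
  · rw [min_eq_left (by linarith : x ≤ t), min_eq_left hsx, min_eq_right hys, max_eq_left hsx,
      max_eq_right (le_min hys hst)]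
    refine hΞ.defect _ ⟨hx0, hsx.trans hs.2⟩ _ hs _
      ⟨le_min (by linarith) ht.1, (min_le_right _ _).trans ht.2⟩ _ ?_ ?_
    · rw [abs_of_nonneg] <;> linarith
    · have := le_min hys hst
      have := min_le_left y t
      rw [abs_of_nonneg] <;> linarith

/-- The sewing lemma. -/
theorem IsSewable.exists_integral [CompleteSpace V] {T K a : ℝ} {Ξ : ℝ → ℝ → V}
    (hΞ : IsSewable T K a Ξ) (hT : 0 ≤ T) (hK : 0 ≤ K) (ha : 1 < a) :
    ∃ I : ℝ → V, I 0 = 0 ∧ ∀ s ∈ Icc 0 T, ∀ t ∈ Icc 0 T, s ≤ t →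
      ‖I t - I s - Ξ s t‖ ≤ sewingConst K a * (t - s) ^ a := by
  have hρ := two_mul_half_rpow_lt_one ha
  have hlim : ∀ t, ∃ x, t ∈ Icc 0 T → Tendsto (fun N => dyadicSum Ξ T N t) atTop (𝓝 x) := by
    intro t
    by_cases ht : t ∈ Icc 0 T
    · obtain ⟨x, hx⟩ := cauchySeq_tendsto_of_complete
        (cauchySeq_of_le_geometric _ _ hρ (hΞ.dist_dyadicSum_succ_le hT hK ha ht))
      exact ⟨x, fun _ => hx⟩
    · exact ⟨0, fun h => absurd h ht⟩
  choose I hI using hlim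
  refine ⟨I, ?_, fun s hs t ht hst => ?_⟩
  · have h0 : (0 : ℝ) ∈ Icc 0 T := ⟨le_rfl, hT⟩
    refine tendsto_nhds_unique (hI 0 h0) ?_
    have : (fun N => dyadicSum Ξ T N 0) = fun _ => 0 := by
      ext N
      refine Finset.sum_eq_zero fun k _ => ?_
      rw [min_eq_right (dyadicPoint_nonneg hT _ _), min_eq_right (dyadicPoint_nonneg hT _ _),
        hΞ.diag 0 h0]
    rw [this]; exact tendsto_const_nhds
  · have hzero : Tendsto (fun N : ℕ => K * T ^ a * (2 * (1 / 2 : ℝ) ^ a) ^ N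
        + sewingConst K a * (t - s) ^ a) atTop (𝓝 (K * T ^ a * 0 + sewingConst K a * (t - s) ^ a)) :=
      ((tendsto_pow_atTop_nhds_zero_of_lt_one (by positivity) hρ).const_mul _).add_const _
    rw [mul_zero, zero_add] at hzero
    refine le_of_tendsto_of_tendsto (((hI t ht).sub (hI s hs)).sub_const (Ξ s t)).norm hzero
      (Eventually.of_forall fun N => ?_)
    -- The increment of the dyadic sums is close to the sum over the grid clamped to `[s, t]`, to
    -- which the partition-independent bound applies.
    have e1 := hΞ.norm_dyadicSum_sub_sub_le hT hK hs ht hst N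
    have e2 := hΞ.norm_sum_sub_le hK ha
      (p := fun k => max s (min (dyadicPoint T N k) t))
      (fun i j hij => max_le_max le_rfl (min_le_min (dyadicPoint_mono hT N hij) le_rfl))
      (fun i => ⟨hs.1.trans (le_max_left _ _), max_le hs.2 ((min_le_right _ _).trans ht.2)⟩)
      (2 ^ N) 0
    simp only [zero_add, dyadicPoint_zero, dyadicPoint_last, min_eq_left ht.1, max_eq_left hs.1,
      min_eq_right ht.2, max_eq_right hst] at e2
    calc _ = ‖(dyadicSum Ξ T N t - dyadicSum Ξ T N s - ∑ k ∈ Finset.range (2 ^ N),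
        Ξ (max s (min (dyadicPoint T N k) t)) (max s (min (dyadicPoint T N (k + 1)) t)))
        + (∑ k ∈ Finset.range (2 ^ N),
        Ξ (max s (min (dyadicPoint T N k) t)) (max s (min (dyadicPoint T N (k + 1)) t))
          - Ξ s t)‖ := by rw [sub_add_sub_cancel]
      _ ≤ _ := (norm_add_le _ _).trans (add_le_add e1 e2)

/-! ### Convergence of Riemann sums as the mesh tends to zero. -/

theorem IntervalPartition.pts_mem {a b : ℝ} (P : IntervalPartition a b) :
    ∀ i ≤ P.N, P.pts i ∈ Icc a b := by
  have hmono : ∀ i j, i ≤ j → j ≤ P.N → P.pts i ≤ P.pts j := by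
    intro i j hij
    induction j, hij using Nat.le_induction with
    | base => exact fun _ => le_rfl
    | succ j _ ih => exact fun hj => (ih (by omega)).trans (P.strict j (by omega)).le
  intro i hi
  exact ⟨P.left.ge.trans (hmono 0 i (Nat.zero_le _) hi), (hmono i P.N hi le_rfl).trans_eq P.right⟩

theorem IntervalPartition.sub_le_mesh {a b : ℝ} (P : IntervalPartition a b) {i : ℕ}
    (hi : i < P.N) : P.pts (i + 1) - P.pts i ≤ P.mesh :=
  le_ciSup (f := fun i : Fin P.N => P.pts (i + 1) - P.pts i) (Set.finite_range _).bddAbove ⟨i, hi⟩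

theorem IntervalPartition.mesh_nonneg {a b : ℝ} (P : IntervalPartition a b) : 0 ≤ P.mesh :=
  Real.iSup_nonneg fun i => by linarith [P.strict i i.2]

theorem meshFilter_neBot {t : ℝ} (ht : 0 ≤ t) : (meshFilter 0 t).NeBot := by
  rw [meshFilter, comap_neBot_iff]
  intro U hU
  obtain ⟨ε, hε, hU⟩ := Metric.mem_nhds_iff.1 hU
  rcases ht.eq_or_lt with rfl | ht
  -- For `t = 0` the partition has no cells, and its mesh is a real supremum over an empty type,
  -- which is 0.
  · refine ⟨⟨0, fun _ => 0, rfl, rfl, fun i hi => absurd hi (Nat.not_lt_zero i)⟩, hU ?_⟩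
    have : IsEmpty (Fin 0) := inferInstance
    simp [IntervalPartition.mesh, hε]
  · obtain ⟨N, hN⟩ := exists_nat_gt (t / ε)
    have hN0 : (0 : ℝ) < N := lt_trans (by positivity) hN
    let P : IntervalPartition 0 t := ⟨N, fun i => i * (t / N), by simp, by field_simp,
      fun i _ => by
        have : 0 < t / N := by positivity
        push_cast; linarith⟩
    refine ⟨P, hU ?_⟩
    rw [Metric.mem_ball, Real.dist_eq, sub_zero, abs_of_nonneg P.mesh_nonneg]
    have : P.mesh ≤ t / N := Real.iSup_le (fun i => le_of_eq (by simp only [P]; push_cast; ring))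
      (by positivity)
    exact this.trans_lt (by rwa [div_lt_iff₀ hN0, mul_comm, ← div_lt_iff₀ hε])

/-- The error on a cell of length `ℓ` is at most `C ℓ ^ a ≤ C mesh ^ (a - 1) ℓ`, and the lengths add
up to `t`. -/
theorem tendsto_sum_meshFilter {T C a : ℝ} {Ξ : ℝ → ℝ → V} {I : ℝ → V} (hC : 0 ≤ C) (ha : 1 < a)
    (hI0 : I 0 = 0)
    (hI : ∀ s ∈ Icc 0 T, ∀ t ∈ Icc 0 T, s ≤ t → ‖I t - I s - Ξ s t‖ ≤ C * (t - s) ^ a)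
    {t : ℝ} (ht : t ∈ Icc 0 T) :
    Tendsto (fun P : IntervalPartition 0 t =>
      ∑ i ∈ Finset.range P.N, Ξ (P.pts i) (P.pts (i + 1))) (meshFilter 0 t) (𝓝 (I t)) := by
  rw [tendsto_iff_norm_sub_tendsto_zero]
  have hlim : Tendsto (fun P : IntervalPartition 0 t => C * t * P.mesh ^ (a - 1)) (meshFilter 0 t)
      (𝓝 (C * t * 0 ^ (a - 1))) :=
    ((Real.continuousAt_rpow_const 0 (a - 1) (Or.inr (by linarith))).tendsto.comp
      tendsto_comap).const_mul _
  rw [Real.zero_rpow (by linarith), mul_zero] at hlim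
  refine squeeze_zero (fun _ => norm_nonneg _) (fun P => ?_) hlim
  have htel : I t = ∑ i ∈ Finset.range P.N, (I (P.pts (i + 1)) - I (P.pts i)) := by
    rw [Finset.sum_range_sub (fun i => I (P.pts i)), P.left, P.right, hI0, sub_zero]
  have htel' : t = ∑ i ∈ Finset.range P.N, (P.pts (i + 1) - P.pts i) := by
    rw [Finset.sum_range_sub P.pts, P.left, P.right, sub_zero]
  have hmem : ∀ i ≤ P.N, P.pts i ∈ Icc 0 T := fun i hi =>
    ⟨(P.pts_mem i hi).1, (P.pts_mem i hi).2.trans ht.2⟩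
  calc _ = ‖∑ i ∈ Finset.range P.N,
        (Ξ (P.pts i) (P.pts (i + 1)) - (I (P.pts (i + 1)) - I (P.pts i)))‖ := by
        rw [Finset.sum_sub_distrib, ← htel]
    _ ≤ ∑ i ∈ Finset.range P.N, C * P.mesh ^ (a - 1) * (P.pts (i + 1) - P.pts i) := by
        refine norm_sum_le_of_le _ fun i hi => ?_
        have hi := Finset.mem_range.1 hi
        have hlt := P.strict i hi
        have hpos : 0 < P.pts (i + 1) - P.pts i := by linarith
        rw [norm_sub_rev]
        refine (hI _ (hmem i hi.le) _ (hmem _ hi) hlt.le).trans ?_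
        rw [mul_assoc]
        refine mul_le_mul_of_nonneg_left ?_ hC
        calc (P.pts (i + 1) - P.pts i) ^ a
            = (P.pts (i + 1) - P.pts i) ^ (a - 1) * (P.pts (i + 1) - P.pts i) := by
              rw [Real.rpow_sub_one hpos.ne']; field_simp
          _ ≤ _ := mul_le_mul_of_nonneg_right
              (Real.rpow_le_rpow hpos.le (P.sub_le_mesh hi) (by linarith)) hpos.le
    _ = C * t * P.mesh ^ (a - 1) := by rw [← Finset.mul_sum, ← htel']; ring

end Sewing

/-! ### The germ of the rough integral and the local expansion. -/

section Germ

variable {n m : ℕ}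

theorem areaTerm_sub_left (G H : Vec n →L[ℝ] Vec n →L[ℝ] Vec m) (x : Area n) :
    areaTerm (G - H) x = areaTerm G x - areaTerm H x := by
  simp [areaTerm, smul_sub, Finset.sum_sub_distrib]

theorem areaTerm_sub_right (G : Vec n →L[ℝ] Vec n →L[ℝ] Vec m) (x y : Area n) :
    areaTerm G (x - y) = areaTerm G x - areaTerm G y := by
  simp [areaTerm, sub_smul, Finset.sum_sub_distrib]

theorem norm_areaTerm_le (G : Vec n →L[ℝ] Vec n →L[ℝ] Vec m) (x : Area n) :
    ‖areaTerm G x‖ ≤ (n : ℝ) ^ 2 * (‖G‖ * ‖x‖) := by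
  have h : ∀ k j : Fin n, ‖x (k, j) • G (EuclideanSpace.single k 1) (EuclideanSpace.single j 1)‖
      ≤ ‖G‖ * ‖x‖ := fun k j => by
    rw [norm_smul, mul_comm]
    refine mul_le_mul ?_ (PiLp.norm_apply_le x (k, j)) (norm_nonneg _) (by positivity)
    simpa using G.le_opNorm₂ (EuclideanSpace.single k 1) (EuclideanSpace.single j 1)
  calc ‖areaTerm G x‖ ≤ ∑ _k : Fin n, ∑ _j : Fin n, ‖G‖ * ‖x‖ :=
        norm_sum_le_of_le _ fun k _ => norm_sum_le_of_le _ fun j _ => h k j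
    _ = (n : ℝ) ^ 2 * (‖G‖ * ‖x‖) := by simp; ring

theorem areaTerm_outer (G : Vec n →L[ℝ] Vec n →L[ℝ] Vec m) (x : Area n) (u v : Vec n)
    (h : ∀ i j, x (i, j) = u i * v j) : areaTerm G x = G u v := by
  have hsum : ∀ w : Vec n, w = ∑ k, w k • EuclideanSpace.single k (1 : ℝ) := fun w => by
    simpa using ((EuclideanSpace.basisFun (Fin n) ℝ).sum_repr w).symm
  conv_rhs => rw [hsum u, hsum v]
  simp only [areaTerm, h, map_sum, map_smul, sum_apply, smul_apply,
    Finset.smul_sum, smul_smul]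
  rw [Finset.sum_comm]
  simp only [mul_comm]

/-- The local expansion `A_s δX_{s,t} + 𝕏_{s,t} A'_s` of the rough integral. -/
def germ (X : ℝ → Vec n) (XX : ℝ → ℝ → Area n) (A : ℝ → Vec n →L[ℝ] Vec m)
    (A' : ℝ → Vec n →L[ℝ] Vec n →L[ℝ] Vec m) (s t : ℝ) : Vec m :=
  A s (incr X s t) + areaTerm (A' s) (XX s t)

/-- Rough path data all of whose norms, as well as the interval length, its inverse and the inverse
of the modulus of roughness, are controlled by the single number `Q`. -/
structure ControlledBy (T γ θ Q : ℝ) (X : ℝ → Vec n) (XX : ℝ → ℝ → Area n)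
    (A : ℝ → Vec n →L[ℝ] Vec m) (A' : ℝ → Vec n →L[ℝ] Vec n →L[ℝ] Vec m) (B : ℝ → Vec m) :
    Prop where
  pos : 0 < T
  lt_exponent : 1 / 3 < γ
  exponent_le : γ ≤ 1
  one_le : 1 ≤ Q
  length_le : T ≤ Q
  inv_le : Q⁻¹ ≤ T / 2
  dim_le : (n : ℝ) ^ 2 ≤ Q
  path : ∀ s ∈ Icc 0 T, ∀ t ∈ Icc 0 T, ‖incr X s t‖ ≤ Q * |t - s| ^ γ
  area : ∀ s ∈ Icc 0 T, ∀ t ∈ Icc 0 T, ‖XX s t‖ ≤ Q * |t - s| ^ (2 * γ)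
  chen : ∀ s ∈ Icc 0 T, ∀ u ∈ Icc 0 T, ∀ t ∈ Icc 0 T, ∀ i j : Fin n,
    XX s t (i, j) - XX u t (i, j) - XX s u (i, j) = incr X s u i * incr X u t j
  rough : RoughWith T θ X Q⁻¹
  initial : ‖A 0‖ ≤ Q
  deriv_sup : ∀ t ∈ Icc 0 T, ‖A' t‖ ≤ Q
  deriv_holder : ∀ s ∈ Icc 0 T, ∀ t ∈ Icc 0 T, ‖incr A' s t‖ ≤ Q * |t - s| ^ γ
  rem : ∀ s ∈ Icc 0 T, ∀ t ∈ Icc 0 T, ‖remainder X A A' s t‖ ≤ Q * |t - s| ^ (2 * γ)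
  drift_cont : ContinuousOn B (Icc 0 T)
  drift_sup : ∀ t ∈ Icc 0 T, ‖B t‖ ≤ Q
  drift_holder : ∀ s ∈ Icc 0 T, ∀ t ∈ Icc 0 T, ‖incr B s t‖ ≤ Q * |t - s| ^ γ

namespace ControlledBy

variable {T γ θ Q : ℝ} {X : ℝ → Vec n} {XX : ℝ → ℝ → Area n} {A : ℝ → Vec n →L[ℝ] Vec m}
  {A' : ℝ → Vec n →L[ℝ] Vec n →L[ℝ] Vec m} {B : ℝ → Vec m}

theorem norm_areaTerm_le (H : ControlledBy T γ θ Q X XX A A' B)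
    (G : Vec n →L[ℝ] Vec n →L[ℝ] Vec m) (x : Area n) : ‖areaTerm G x‖ ≤ Q * (‖G‖ * ‖x‖) :=
  (NorrisRP.norm_areaTerm_le G x).trans (mul_le_mul_of_nonneg_right H.dim_le (by positivity))

/-- Chen's relation produces `A'_s δX_{s,u} δX_{u,t}`, which cancels the first-order part of
`δA_{s,u} δX_{u,t}`. What survives is of order `2γ + γ` in both terms. -/
theorem germ_defect (H : ControlledBy T γ θ Q X XX A A' B) {s u t : ℝ} (hs : s ∈ Icc 0 T)
    (hu : u ∈ Icc 0 T) (ht : t ∈ Icc 0 T) :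
    germ X XX A A' s t - germ X XX A A' s u - germ X XX A A' u t
      = -(remainder X A A' s u (incr X u t)) - areaTerm (incr A' s u) (XX u t) := by
  have h1 : areaTerm (A' s) (XX s t) - areaTerm (A' s) (XX u t) - areaTerm (A' s) (XX s u)
      = A' s (incr X s u) (incr X u t) := by
    rw [← areaTerm_sub_right, ← areaTerm_sub_right]
    exact areaTerm_outer _ _ _ _ (H.chen s hs u hu t ht)
  have h2 : incr X s t = incr X s u + incr X u t := by simp [incr]
  have h3 : areaTerm (A' s) (XX s t) = A' s (incr X s u) (incr X u t)
      + areaTerm (A' s) (XX u t) + areaTerm (A' s) (XX s u) := by rw [← h1]; abel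
  have h4 : areaTerm (incr A' s u) (XX u t)
      = areaTerm (A' u) (XX u t) - areaTerm (A' s) (XX u t) := areaTerm_sub_left _ _ _
  have h5 : remainder X A A' s u (incr X u t)
      = A u (incr X u t) - A s (incr X u t) - A' s (incr X s u) (incr X u t) := by
    simp [remainder, incr]
  simp only [germ]
  rw [h2, h3, h4, h5, map_add]
  abel

theorem germ_isSewable (H : ControlledBy T γ θ Q X XX A A' B) :
    IsSewable T (2 * Q ^ 3) (3 * γ) (germ X XX A A') where
  diag s hs := by
    have hγ := H.lt_exponent
    have h1 := H.area s hs s hs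
    rw [sub_self, abs_zero, Real.zero_rpow (by linarith), mul_zero, norm_le_zero_iff] at h1
    simp [germ, h1, incr, areaTerm]
  defect s hs u hu t ht h h1 h2 := by
    have hγ := H.lt_exponent
    have hQ := H.one_le
    have hh : 0 ≤ h := (abs_nonneg _).trans h1
    have e1 : |u - s| ^ γ ≤ h ^ γ := Real.rpow_le_rpow (abs_nonneg _) h1 (by linarith)
    have e2 : |t - u| ^ γ ≤ h ^ γ := Real.rpow_le_rpow (abs_nonneg _) h2 (by linarith)
    have e3 : |u - s| ^ (2 * γ) ≤ h ^ (2 * γ) := Real.rpow_le_rpow (abs_nonneg _) h1 (by linarith)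
    have e4 : |t - u| ^ (2 * γ) ≤ h ^ (2 * γ) := Real.rpow_le_rpow (abs_nonneg _) h2 (by linarith)
    have f1 : ‖remainder X A A' s u (incr X u t)‖ ≤ (Q * h ^ (2 * γ)) * (Q * h ^ γ) :=
      (ContinuousLinearMap.le_opNorm _ _).trans (mul_le_mul
        ((H.rem s hs u hu).trans (by gcongr)) ((H.path u hu t ht).trans (by gcongr))
        (norm_nonneg _) (by positivity))
    have f2 : ‖areaTerm (incr A' s u) (XX u t)‖ ≤ Q * ((Q * h ^ γ) * (Q * h ^ (2 * γ))) :=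
      (H.norm_areaTerm_le _ _).trans (mul_le_mul_of_nonneg_left (mul_le_mul
        ((H.deriv_holder s hs u hu).trans (by gcongr)) ((H.area u hu t ht).trans (by gcongr))
        (norm_nonneg _) (by positivity)) (by linarith))
    have e5 : h ^ (3 * γ) = h ^ γ * h ^ (2 * γ) := by
      rw [← Real.rpow_add_of_nonneg hh (by linarith) (by linarith)]; congr 1; ring
    rw [H.germ_defect hs hu ht]
    refine (norm_sub_le _ _).trans ?_
    rw [norm_neg]
    have hpos : 0 ≤ h ^ γ * h ^ (2 * γ) := by positivity
    have hQ3 : Q ^ 2 ≤ Q ^ 3 := pow_le_pow_right₀ hQ (by norm_num)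
    calc _ ≤ _ := add_le_add f1 f2
      _ = (Q ^ 2 + Q ^ 3) * (h ^ γ * h ^ (2 * γ)) := by ring
      _ ≤ (2 * Q ^ 3) * (h ^ γ * h ^ (2 * γ)) := by gcongr; linarith
      _ = _ := by rw [e5]

theorem exists_integral (H : ControlledBy T γ θ Q X XX A A' B) :
    ∃ I : ℝ → Vec m, I 0 = 0 ∧ ∀ s ∈ Icc 0 T, ∀ t ∈ Icc 0 T, s ≤ t →
      ‖I t - I s - germ X XX A A' s t‖ ≤ sewingConst (2 * Q ^ 3) (3 * γ) * (t - s) ^ (3 * γ) :=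
  H.germ_isSewable.exists_integral H.pos.le (by have := H.one_le; positivity)
    (by linarith [H.lt_exponent])

theorem sewingConst_pos (H : ControlledBy T γ θ Q X XX A A' B) :
    0 ≤ sewingConst (2 * Q ^ 3) (3 * γ) :=
  sewingConst_nonneg (by have := H.one_le; positivity) (by linarith [H.lt_exponent])

theorem tendsto_riemannSum (H : ControlledBy T γ θ Q X XX A A' B) {t : ℝ} (ht : t ∈ Icc 0 T) :
    Tendsto (fun P => riemannSum X XX A A' P) (meshFilter 0 t)
      (𝓝 (roughIntegral X XX A A' t)) := by
  obtain ⟨I, h0, hI⟩ := H.exists_integral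
  exact tendsto_nhds_limUnder ⟨I t, tendsto_sum_meshFilter H.sewingConst_pos
    (by linarith [H.lt_exponent]) h0 hI ht⟩

theorem exists_roughIntegral_eq (H : ControlledBy T γ θ Q X XX A A' B) :
    roughIntegral X XX A A' 0 = 0 ∧ ∀ s ∈ Icc 0 T, ∀ t ∈ Icc 0 T, s ≤ t →
      ‖roughIntegral X XX A A' t - roughIntegral X XX A A' s - germ X XX A A' s t‖
        ≤ sewingConst (2 * Q ^ 3) (3 * γ) * (t - s) ^ (3 * γ) := by
  obtain ⟨I, h0, hI⟩ := H.exists_integral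
  have heq : ∀ t ∈ Icc 0 T, roughIntegral X XX A A' t = I t := fun t ht => by
    have := meshFilter_neBot ht.1
    exact tendsto_nhds_unique (H.tendsto_riemannSum ht) (tendsto_sum_meshFilter H.sewingConst_pos
      (by linarith [H.lt_exponent]) h0 hI ht)
  refine ⟨by rw [heq 0 ⟨le_rfl, H.pos.le⟩, h0], fun s hs t ht hst => ?_⟩
  rw [heq s hs, heq t ht]
  exact hI s hs t ht hst

/-- The constant in the local expansion of the rough integral. -/
def expansionConst (γ : ℝ) : ℝ := sewingConst 2 (3 * γ) + 2

theorem two_le_expansionConst (hγ : 1 / 3 < γ) : 2 ≤ expansionConst γ := by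
  have := sewingConst_nonneg (K := 2) (a := 3 * γ) (by norm_num) (by linarith)
  unfold expansionConst; linarith

theorem norm_roughIntegral_sub_germ_le (H : ControlledBy T γ θ Q X XX A A' B) {s t : ℝ}
    (hs : s ∈ Icc 0 T) (ht : t ∈ Icc 0 T) :
    ‖roughIntegral X XX A A' t - roughIntegral X XX A A' s - germ X XX A A' s t‖
      ≤ expansionConst γ * Q ^ 3 * |t - s| ^ (3 * γ) := by
  have hQ := H.one_le
  have hc : sewingConst (2 * Q ^ 3) (3 * γ) = sewingConst 2 (3 * γ) * Q ^ 3 := by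
    unfold sewingConst; ring
  have hexp : expansionConst γ * Q ^ 3 * |t - s| ^ (3 * γ)
      = sewingConst (2 * Q ^ 3) (3 * γ) * |t - s| ^ (3 * γ)
        + 2 * Q ^ 3 * |t - s| ^ (3 * γ) := by rw [hc, expansionConst]; ring
  rw [hexp]
  rcases le_total s t with h | h
  · have := H.exists_roughIntegral_eq.2 s hs t ht h
    rw [abs_of_nonneg (by linarith)]
    have : 0 ≤ 2 * Q ^ 3 * (t - s) ^ (3 * γ) := by
      have : 0 ≤ t - s := by linarith
      positivity
    linarith
  · have e1 := H.exists_roughIntegral_eq.2 t ht s hs h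
    -- Backward increments reduce to forward ones: `germ s t + germ t s` is minus the defect of the
    -- loop `s, t, s`, which accounts for the `+ 2` in `expansionConst`.
    have e2 := H.germ_isSewable.defect s hs t ht s hs |t - s| le_rfl (abs_sub_comm _ _).le
    rw [H.germ_isSewable.diag s hs] at e2
    rw [← abs_of_nonneg (show 0 ≤ s - t by linarith), abs_sub_comm s t] at e1
    calc _ = ‖-(roughIntegral X XX A A' s - roughIntegral X XX A A' t - germ X XX A A' t s)
          + (0 - germ X XX A A' s t - germ X XX A A' t s)‖ := by congr 1; abel
      _ ≤ _ := (norm_add_le _ _).trans (add_le_add (by rwa [norm_neg]) e2)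

theorem intervalIntegrable (H : ControlledBy T γ θ Q X XX A A' B) {s t : ℝ}
    (hs : s ∈ Icc 0 T) (ht : t ∈ Icc 0 T) : IntervalIntegrable B MeasureTheory.volume s t :=
  (H.drift_cont.mono (ordConnected_Icc.uIcc_subset hs ht)).intervalIntegrable

theorem norm_integral_le (H : ControlledBy T γ θ Q X XX A A' B) {s t : ℝ}
    (hs : s ∈ Icc 0 T) (ht : t ∈ Icc 0 T) : ‖∫ r in s..t, B r‖ ≤ Q * |t - s| :=
  intervalIntegral.norm_integral_le_of_norm_le_const fun r hr =>
    H.drift_sup r (ordConnected_Icc.uIcc_subset hs ht (uIoc_subset_uIcc hr))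

theorem norm_integral_sub_le (H : ControlledBy T γ θ Q X XX A A' B) {s t : ℝ}
    (hs : s ∈ Icc 0 T) (ht : t ∈ Icc 0 T) :
    ‖(∫ r in s..t, B r) - (t - s) • B s‖ ≤ Q * |t - s| ^ γ * |t - s| := by
  rw [← intervalIntegral.integral_const, ← intervalIntegral.integral_sub
    (H.intervalIntegrable hs ht) intervalIntegrable_const]
  refine intervalIntegral.norm_integral_le_of_norm_le_const fun r hr => ?_
  have hr' := uIoc_subset_uIcc hr
  refine (H.drift_holder s hs r (ordConnected_Icc.uIcc_subset hs ht hr')).trans ?_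
  have hγ := H.lt_exponent
  have := H.one_le
  gcongr Q * ?_ ^ γ
  exact abs_sub_left_of_mem_uIcc hr'

theorem integralPath_sub (H : ControlledBy T γ θ Q X XX A A' B) {s t : ℝ}
    (hs : s ∈ Icc 0 T) (ht : t ∈ Icc 0 T) :
    integralPath X XX A A' B t - integralPath X XX A A' B s
      = roughIntegral X XX A A' t - roughIntegral X XX A A' s + ∫ r in s..t, B r := by
  have h0 : (0 : ℝ) ∈ Icc 0 T := ⟨le_rfl, H.pos.le⟩
  rw [← intervalIntegral.integral_interval_sub_left (H.intervalIntegrable h0 ht)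
    (H.intervalIntegrable h0 hs)]
  simp only [integralPath]; abel

/-- Without boundedness `supNorm`, a real `sSup`, would not dominate the values of the path. -/
theorem bddAbove_integralPath (H : ControlledBy T γ θ Q X XX A A' B) :
    BddAbove ((fun t => ‖integralPath X XX A A' B t‖) '' Icc 0 T) := by
  have hγ := H.lt_exponent
  have hQ := H.one_le
  have hT := H.pos
  have h0 : (0 : ℝ) ∈ Icc 0 T := ⟨le_rfl, H.pos.le⟩
  have hC := two_le_expansionConst hγ
  refine ⟨expansionConst γ * Q ^ 3 * T ^ (3 * γ) + (‖A 0‖ * (Q * T ^ γ)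
    + Q * (‖A' 0‖ * (Q * T ^ (2 * γ)))) + Q * T, ?_⟩
  rintro _ ⟨t, ht, rfl⟩
  have habs : |t - 0| ≤ T := by rw [sub_zero, abs_of_nonneg ht.1]; exact ht.2
  have e1 := H.norm_roughIntegral_sub_germ_le h0 ht
  have e2 := H.norm_integral_le h0 ht
  have e3 : ‖germ X XX A A' 0 t‖ ≤ ‖A 0‖ * (Q * T ^ γ) + Q * (‖A' 0‖ * (Q * T ^ (2 * γ))) := by
    refine (norm_add_le _ _).trans (add_le_add ((A 0).le_opNorm_of_le ((H.path 0 h0 t ht).trans ?_))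
      ((H.norm_areaTerm_le _ _).trans ?_))
    · gcongr
    · gcongr
      exact (H.area 0 h0 t ht).trans (by gcongr)
  rw [H.exists_roughIntegral_eq.1, sub_zero] at e1
  have hdec : integralPath X XX A A' B t = (roughIntegral X XX A A' t - germ X XX A A' 0 t)
      + germ X XX A A' 0 t + ∫ r in (0 : ℝ)..t, B r := by simp [integralPath]
  dsimp only
  rw [hdec]
  refine (norm_add_le _ _).trans (add_le_add ((norm_add_le _ _).trans
    (add_le_add (e1.trans ?_) e3)) (e2.trans ?_))
  · gcongr
  · gcongr

end ControlledBy

end Germ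

/-! ### Roughness and the choice of scale. -/

section Roughness

variable {n : ℕ} {F : Type*} [NormedAddCommGroup F] [NormedSpace ℝ F]

/-- A rough path sees every direction: a linear map which is small on all the increments of `X`
near `s` is small. -/
theorem RoughWith.norm_mul_le {T θ L : ℝ} {X : ℝ → Vec n} (hX : RoughWith T θ X L) {s ε b : ℝ}
    (hs : s ∈ Icc 0 T) (hε : ε ∈ Ioc 0 (T / 2)) (hL : 0 ≤ L) (hb : 0 ≤ b) (G : Vec n →L[ℝ] F)
    (hG : ∀ t ∈ Icc 0 T, |t - s| < ε → ‖G (incr X s t)‖ ≤ b) : ‖G‖ * (L * ε ^ θ) ≤ b := by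
  have hpos : 0 ≤ L * ε ^ θ := mul_nonneg hL (Real.rpow_nonneg hε.1.le _)
  -- Roughness concerns scalar projections of `X`, so `G` is tested against functionals: `ℓ ∘ G` is
  -- the inner product with its Riesz vector `v`, whose direction is the `φ` used. A norming
  -- functional then recovers `‖G‖`.
  have key : ∀ ℓ : F →L[ℝ] ℝ, ‖ℓ‖ ≤ 1 → ‖ℓ.comp G‖ * (L * ε ^ θ) ≤ b := by
    intro ℓ hℓ
    set v := (InnerProductSpace.toDual ℝ (Vec n)).symm (ℓ.comp G) with hv
    have hvn : ‖v‖ = ‖ℓ.comp G‖ := by rw [hv, LinearIsometryEquiv.norm_map]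
    have hvi : ∀ x, inner ℝ v x = ℓ (G x) := fun x => by
      rw [hv, InnerProductSpace.toDual_symm_apply]; rfl
    rw [← hvn]
    by_cases h0 : v = 0
    · simpa [h0] using hb
    have hv0 : 0 < ‖v‖ := norm_pos_iff.2 h0
    obtain ⟨t, ht, -, h1, h2⟩ := hX s hs ε hε (‖v‖⁻¹ • v) (norm_smul_inv_norm h0)
    rw [real_inner_smul_left, abs_mul, abs_of_pos (inv_pos.2 hv0), hvi] at h2
    calc ‖v‖ * (L * ε ^ θ) ≤ ‖v‖ * (‖v‖⁻¹ * |ℓ (G (incr X s t))|) := by gcongr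
      _ = |ℓ (G (incr X s t))| := by field_simp
      _ ≤ 1 * ‖G (incr X s t)‖ := ℓ.le_of_opNorm_le hℓ _
      _ ≤ b := by rw [one_mul]; exact hG t ht h1
  rcases hpos.eq_or_lt with h0 | hpos'
  · rw [← h0, mul_zero]; exact hb
  rw [← le_div_iff₀ hpos']
  refine G.opNorm_le_bound (by positivity) fun x => ?_
  obtain ⟨ℓ, hℓ, hℓx⟩ := exists_dual_vector'' ℝ (G x)
  have h1 := (ℓ.comp G).le_opNorm x
  rw [ContinuousLinearMap.comp_apply, hℓx] at h1
  simp only [RCLike.ofReal_real_eq_id, id_eq, norm_norm] at h1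
  exact h1.trans (mul_le_mul_of_nonneg_right ((le_div_iff₀ hpos').2 (key ℓ hℓ)) (norm_nonneg _))

end Roughness

/-- Optimisation over the scale `ε`. -/
theorem le_mul_rpow_of_forall_scale {a P D Q w θ β : ℝ} (hP : 0 ≤ P) (hD : 0 ≤ D)
    (hQ : 1 ≤ Q) (hw : 0 < w) (hw1 : w ≤ 1) (hθ : 0 < θ) (hθ1 : θ ≤ 1) (hβ : θ < β)
    (h : ∀ ε ∈ Ioc 0 Q⁻¹, a * ε ^ θ ≤ P * w + D * ε ^ β) :
    a ≤ (P + D) * Q * w ^ (1 - θ / β) := by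
  have hβ0 : 0 < β := hθ.trans hβ
  have hQ0 : 0 < Q := by linarith
  -- This scale makes `ε ^ β ≤ w`, so both terms on the right are of size `w`; the factor `Q⁻¹`
  -- keeps `ε` admissible and costs only `Q ^ θ ≤ Q`.
  have hε := h (w ^ (1 / β) * Q⁻¹) ⟨by positivity,
    mul_le_of_le_one_left (by positivity) (Real.rpow_le_one hw.le hw1 (by positivity))⟩
  have e1 : (w ^ (1 / β) * Q⁻¹) ^ θ = w ^ (θ / β) * (Q ^ θ)⁻¹ := by
    rw [Real.mul_rpow (by positivity) (by positivity), ← Real.rpow_mul hw.le, Real.inv_rpow hQ0.le]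
    congr 2; ring
  have e2 : (w ^ (1 / β) * Q⁻¹) ^ β ≤ w := by
    rw [Real.mul_rpow (by positivity) (by positivity), ← Real.rpow_mul hw.le,
      one_div_mul_cancel hβ0.ne', Real.rpow_one]
    exact mul_le_of_le_one_right hw.le
      (Real.rpow_le_one (by positivity) (inv_le_one_of_one_le₀ hQ) hβ0.le)
  have hQθ : Q ^ θ ≤ Q := by
    simpa using Real.rpow_le_rpow_of_exponent_le hQ hθ1
  rw [e1] at hε
  have hbound : a * (w ^ (θ / β) * (Q ^ θ)⁻¹) ≤ (P + D) * w := by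
    calc _ ≤ _ := hε
      _ ≤ P * w + D * w := by gcongr
      _ = _ := by ring
  have hQθ0 : 0 < Q ^ θ := by positivity
  have hwθ : 0 < w ^ (θ / β) := by positivity
  calc a = a * (w ^ (θ / β) * (Q ^ θ)⁻¹) * Q ^ θ / w ^ (θ / β) := by field_simp
    _ ≤ (P + D) * w * Q / w ^ (θ / β) := by gcongr
    _ = (P + D) * Q * w ^ (1 - θ / β) := by rw [Real.rpow_sub hw, Real.rpow_one]; ring

/-! ### Successive estimates of `A`, `A'` and `B`. -/

namespace ControlledBy

variable {n m : ℕ} {T γ θ Q : ℝ} {X : ℝ → Vec n} {XX : ℝ → ℝ → Area n}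
  {A : ℝ → Vec n →L[ℝ] Vec m} {A' : ℝ → Vec n →L[ℝ] Vec n →L[ℝ] Vec m} {B : ℝ → Vec m}

/-- The engine for both `A` and `A'`. One factor `Q` inverts the roughness constant `Q⁻¹`, the other
comes from the choice of scale. -/
theorem norm_le_of_rough {F : Type*} [NormedAddCommGroup F] [NormedSpace ℝ F]
    (H : ControlledBy T γ θ Q X XX A A' B) {s P D w β : ℝ} (hs : s ∈ Icc 0 T) (hP : 0 ≤ P)
    (hD : 0 ≤ D) (hw : 0 < w) (hw1 : w ≤ 1) (hθ : 0 < θ) (hθ1 : θ < 1) (hβ : θ < β)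
    (G : Vec n →L[ℝ] F)
    (hG : ∀ t ∈ Icc 0 T, |t - s| ≤ 1 → ‖G (incr X s t)‖ ≤ P * w + D * |t - s| ^ β) :
    ‖G‖ ≤ (P + D) * Q ^ 2 * w ^ (1 - θ / β) := by
  have hQ := H.one_le
  have hQ0 : 0 < Q := by linarith
  have hβ0 : 0 ≤ β := by linarith
  have key := le_mul_rpow_of_forall_scale (a := ‖G‖) (mul_nonneg hQ0.le hP) (mul_nonneg hQ0.le hD)
    hQ hw hw1 hθ hθ1.le hβ fun ε hε => ?_
  · calc _ ≤ _ := key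
      _ = _ := by ring
  · have hε0 : 0 < ε := hε.1
    have h1 : Q⁻¹ ≤ 1 := inv_le_one_of_one_le₀ hQ
    have := H.rough.norm_mul_le (b := P * w + D * ε ^ β) hs ⟨hε.1, hε.2.trans H.inv_le⟩
      (by positivity) (by positivity) G fun t ht hts => by
        refine (hG t ht (by linarith [hε.2])).trans ?_
        gcongr
    calc ‖G‖ * ε ^ θ = Q * (‖G‖ * (Q⁻¹ * ε ^ θ)) := by field_simp
      _ ≤ Q * (P * w + D * ε ^ β) := by gcongr
      _ = _ := by ring

/-- Solve the local expansion of `Z` for its leading term. The area term has order `2γ` and the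
drift order 1, hence the minimum. -/
theorem norm_integrand_incr_le (H : ControlledBy T γ θ Q X XX A A' B) {z s t : ℝ}
    (hz : ∀ t ∈ Icc 0 T, ‖integralPath X XX A A' B t‖ ≤ z)
    (hs : s ∈ Icc 0 T) (ht : t ∈ Icc 0 T) (hst : |t - s| ≤ 1) :
    ‖A s (incr X s t)‖
      ≤ 2 * z + (expansionConst γ + 2) * Q ^ 3 * |t - s| ^ min (2 * γ) 1 := by
  have hγ := H.lt_exponent
  have hQ := H.one_le
  have hC := two_le_expansionConst hγ
  set h := |t - s| with hh
  have hh0 : 0 ≤ h := abs_nonneg _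
  have hβ : 0 < min (2 * γ) 1 := lt_min (by linarith) one_pos
  have mono : ∀ α, min (2 * γ) 1 ≤ α → h ^ α ≤ h ^ min (2 * γ) 1 := fun α hα =>
    Real.rpow_le_rpow_of_exponent_ge_of_imp hh0 hst hα (fun _ h0 => by linarith)
  have m1 := mono (2 * γ) (min_le_left _ _)
  have m2 := mono (3 * γ) ((min_le_left _ _).trans (by linarith))
  have m3 := mono 1 (min_le_right _ _)
  rw [Real.rpow_one] at m3
  have e1 := H.norm_roughIntegral_sub_germ_le hs ht
  have e2 := H.norm_integral_le hs ht
  have e3 : ‖areaTerm (A' s) (XX s t)‖ ≤ Q * (Q * (Q * h ^ (2 * γ))) :=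
    (H.norm_areaTerm_le _ _).trans (by
      have := H.deriv_sup s hs
      have := H.area s hs t ht
      gcongr)
  have e4 : ‖integralPath X XX A A' B t - integralPath X XX A A' B s‖ ≤ 2 * z :=
    (norm_sub_le _ _).trans (by linarith [hz s hs, hz t ht])
  rw [H.integralPath_sub hs ht] at e4
  have hdec : A s (incr X s t)
      = (roughIntegral X XX A A' t - roughIntegral X XX A A' s + ∫ r in s..t, B r)
        - (roughIntegral X XX A A' t - roughIntegral X XX A A' s - germ X XX A A' s t)
        - areaTerm (A' s) (XX s t) - ∫ r in s..t, B r := by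
    simp only [germ]; abel
  have hQ1 : Q ≤ Q ^ 3 := le_self_pow₀ hQ (by norm_num)
  rw [hdec]
  calc _ ≤ 2 * z + expansionConst γ * Q ^ 3 * h ^ (3 * γ) + Q * (Q * (Q * h ^ (2 * γ))) + Q * h :=
        (norm_sub_le _ _).trans (add_le_add ((norm_sub_le _ _).trans (add_le_add
          ((norm_sub_le _ _).trans (add_le_add e4 e1)) e3)) e2)
    _ ≤ 2 * z + expansionConst γ * Q ^ 3 * h ^ min (2 * γ) 1
        + Q * (Q * (Q * h ^ min (2 * γ) 1)) + Q ^ 3 * h ^ min (2 * γ) 1 := by gcongr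
    _ = _ := by ring

theorem norm_deriv_incr_le (H : ControlledBy T γ θ Q X XX A A' B) {α s t : ℝ}
    (hα : ∀ t ∈ Icc 0 T, ‖A t‖ ≤ α) (hs : s ∈ Icc 0 T) (ht : t ∈ Icc 0 T) :
    ‖A' s (incr X s t)‖ ≤ 2 * α + Q * |t - s| ^ (2 * γ) := by
  have hdec : A' s (incr X s t) = A t - A s - remainder X A A' s t := by simp [remainder, incr]
  rw [hdec]
  refine (norm_sub_le _ _).trans (add_le_add ((norm_sub_le _ _).trans ?_) (H.rem s hs t ht))
  linarith [hα s hs, hα t ht]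

/-- Here the drift is kept as the main term. Replacing `B` by `B_s` costs order `1 + γ`, so every
error not already multiplied by `z`, `‖A s‖` or `‖A' s‖` has order above 1. -/
theorem mul_norm_drift_le (H : ControlledBy T γ θ Q X XX A A' B) {z s t : ℝ}
    (hz : ∀ t ∈ Icc 0 T, ‖integralPath X XX A A' B t‖ ≤ z)
    (hs : s ∈ Icc 0 T) (ht : t ∈ Icc 0 T) (hst : |t - s| ≤ 1) :
    |t - s| * ‖B s‖ ≤ 2 * z + ‖A s‖ * Q + ‖A' s‖ * Q ^ 2
      + (expansionConst γ + 1) * Q ^ 3 * |t - s| ^ min (3 * γ) (1 + γ) := by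
  have hγ := H.lt_exponent
  have hQ := H.one_le
  have hC := two_le_expansionConst hγ
  set h := |t - s| with hh
  have hh0 : 0 ≤ h := abs_nonneg _
  have hβ : 0 < min (3 * γ) (1 + γ) := lt_min (by linarith) (by linarith)
  have mono : ∀ α, min (3 * γ) (1 + γ) ≤ α → h ^ α ≤ h ^ min (3 * γ) (1 + γ) := fun α hα =>
    Real.rpow_le_rpow_of_exponent_ge_of_imp hh0 hst hα (fun _ h0 => by linarith)
  have m1 := mono (3 * γ) (min_le_left _ _)
  have m2 := mono (1 + γ) (min_le_right _ _)
  have m3 : h ^ γ * h = h ^ (1 + γ) := by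
    rw [Real.rpow_add_of_nonneg hh0 zero_le_one (by linarith), Real.rpow_one, mul_comm]
  have n1 : h ^ γ ≤ 1 := Real.rpow_le_one hh0 hst (by linarith)
  have n2 : h ^ (2 * γ) ≤ 1 := Real.rpow_le_one hh0 hst (by linarith)
  have e1 := H.norm_roughIntegral_sub_germ_le hs ht
  have e2 := H.norm_integral_sub_le hs ht
  have e3 : ‖areaTerm (A' s) (XX s t)‖ ≤ Q * (‖A' s‖ * (Q * 1)) :=
    (H.norm_areaTerm_le _ _).trans (by
      have := (H.area s hs t ht).trans (mul_le_mul_of_nonneg_left n2 (by linarith))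
      gcongr)
  have e5 : ‖A s (incr X s t)‖ ≤ ‖A s‖ * (Q * 1) :=
    (A s).le_opNorm_of_le ((H.path s hs t ht).trans (mul_le_mul_of_nonneg_left n1 (by linarith)))
  have e4 : ‖integralPath X XX A A' B t - integralPath X XX A A' B s‖ ≤ 2 * z :=
    (norm_sub_le _ _).trans (by linarith [hz s hs, hz t ht])
  rw [H.integralPath_sub hs ht] at e4
  have hdec : (t - s) • B s
      = (roughIntegral X XX A A' t - roughIntegral X XX A A' s + ∫ r in s..t, B r)
        - (roughIntegral X XX A A' t - roughIntegral X XX A A' s - germ X XX A A' s t)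
        - A s (incr X s t) - areaTerm (A' s) (XX s t)
        - ((∫ r in s..t, B r) - (t - s) • B s) := by
    simp only [germ]; abel
  have hQ1 : Q ≤ Q ^ 3 := le_self_pow₀ hQ (by norm_num)
  have hn : h * ‖B s‖ = ‖(t - s) • B s‖ := by rw [norm_smul, Real.norm_eq_abs]
  rw [hn, hdec]
  rw [mul_assoc, m3] at e2
  calc _ ≤ 2 * z + expansionConst γ * Q ^ 3 * h ^ (3 * γ) + ‖A s‖ * (Q * 1)
        + Q * (‖A' s‖ * (Q * 1)) + Q * h ^ (1 + γ) :=
        (norm_sub_le _ _).trans (add_le_add ((norm_sub_le _ _).trans (add_le_add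
          ((norm_sub_le _ _).trans (add_le_add ((norm_sub_le _ _).trans
            (add_le_add e4 e1)) e5)) e3)) e2)
    _ ≤ 2 * z + expansionConst γ * Q ^ 3 * h ^ min (3 * γ) (1 + γ) + ‖A s‖ * (Q * 1)
        + Q * (‖A' s‖ * (Q * 1)) + Q ^ 3 * h ^ min (3 * γ) (1 + γ) := by gcongr
    _ = _ := by ring

/-- The exponent gained when the integrand is estimated by the integral. -/
def integrandExponent (γ θ : ℝ) : ℝ := 1 - θ / min (2 * γ) 1

/-- The exponent gained when the drift is estimated. -/
def driftExponent (γ : ℝ) : ℝ := 1 - 1 / min (3 * γ) (1 + γ)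

theorem integrandExponent_mem (hγ : 1 / 3 < γ) (hθ : 0 < θ) (hθ1 : θ < 1) (hθγ : θ < 2 * γ) :
    0 < integrandExponent γ θ ∧ integrandExponent γ θ ≤ 1 := by
  have hβ : 0 < min (2 * γ) 1 := lt_min (by linarith) one_pos
  have h1 : θ / min (2 * γ) 1 < 1 := (div_lt_one hβ).2 (lt_min hθγ hθ1)
  have h2 : 0 ≤ θ / min (2 * γ) 1 := by positivity
  unfold integrandExponent
  constructor <;> linarith

theorem driftExponent_mem (hγ : 1 / 3 < γ) : 0 < driftExponent γ ∧ driftExponent γ ≤ 1 := by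
  have hβ : 1 < min (3 * γ) (1 + γ) := lt_min (by linarith) (by linarith)
  have h1 : 1 / min (3 * γ) (1 + γ) < 1 := (div_lt_one (by linarith)).2 hβ
  have h2 : 0 ≤ 1 / min (3 * γ) (1 + γ) := by positivity
  unfold driftExponent
  constructor <;> linarith

/-- The exponent in Norris' lemma before the constant is made uniform. -/
def norrisExponent (γ θ : ℝ) : ℝ :=
  integrandExponent γ θ * integrandExponent γ θ * driftExponent γ

/-- The constant in Norris' lemma for a path which is at most one. -/
def norrisConst (γ : ℝ) : ℝ := 5 * expansionConst γ + 20

theorem exists_shift {δ : ℝ} (hδ : 0 < δ) (hδT : δ ≤ T / 2) {s : ℝ} (hs : s ∈ Icc 0 T) :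
    ∃ t ∈ Icc 0 T, |t - s| = δ := by
  rcases le_total s (T / 2) with h | h
  · exact ⟨s + δ, ⟨by linarith [hs.1], by linarith⟩, by simp [abs_of_pos hδ]⟩
  · exact ⟨s - δ, ⟨by linarith, by linarith [hs.2]⟩, by simp [abs_of_pos hδ]⟩

/-- Norris' lemma for a small path, with a constant depending on `γ`. -/
theorem norm_add_norm_le_of_le_one (H : ControlledBy T γ θ Q X XX A A' B) (hθ : 0 < θ)
    (hθ1 : θ < 1) (hθγ : θ < 2 * γ) {z : ℝ} (hz0 : 0 < z) (hz1 : z ≤ 1)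
    (hz : ∀ t ∈ Icc 0 T, ‖integralPath X XX A A' B t‖ ≤ z) {s t : ℝ} (hs : s ∈ Icc 0 T)
    (ht : t ∈ Icc 0 T) :
    ‖A s‖ + ‖B t‖ ≤ norrisConst γ * Q ^ 10 * z ^ norrisExponent γ θ := by
  have hγ := H.lt_exponent
  have hQ := H.one_le
  have hQ0 : 0 < Q := by linarith
  have hC := two_le_expansionConst hγ
  obtain ⟨hη0, hη1⟩ := integrandExponent_mem hγ hθ hθ1 hθγ
  obtain ⟨hδ0, hδ1⟩ := driftExponent_mem hγ
  have hβ : θ < min (2 * γ) 1 := lt_min hθγ hθ1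
  set C := expansionConst γ
  set η := integrandExponent γ θ with hη
  have pQ : ∀ {i j : ℕ}, i ≤ j → Q ^ i ≤ Q ^ j := fun hij => pow_le_pow_right₀ hQ hij
  -- The sizes of `A` and `A'` up to constants are `y` and `w`; since `z ≤ y ≤ w ≤ 1`, all inputs to
  -- the drift estimate are dominated by `w`.
  set y := z ^ η with hy
  set w := y ^ η with hw
  have hy0 : 0 < y := by positivity
  have hw0 : 0 < w := by positivity
  have hy1 : y ≤ 1 := Real.rpow_le_one hz0.le hz1 hη0.le
  have hw1 : w ≤ 1 := Real.rpow_le_one hy0.le hy1 hη0.le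
  have hzy : z ≤ y := by
    simpa using Real.rpow_le_rpow_of_exponent_ge hz0 hz1 hη1
  have hyw : y ≤ w := by
    simpa using Real.rpow_le_rpow_of_exponent_ge hy0 hy1 hη1
  have hwd : w ≤ w ^ driftExponent γ := by
    simpa using Real.rpow_le_rpow_of_exponent_ge hw0 hw1 hδ1
  have hA : ∀ s ∈ Icc 0 T, ‖A s‖ ≤ (C + 4) * Q ^ 5 * y := fun s hs => by
    have := H.norm_le_of_rough hs zero_le_two (D := (C + 2) * Q ^ 3) (by positivity) hz0 hz1 hθ hθ1 hβ
      (A s) fun t ht hts => H.norm_integrand_incr_le hz hs ht hts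
    refine this.trans ?_
    have h3 : 1 ≤ Q ^ 3 := one_le_pow₀ hQ
    calc _ ≤ (2 * Q ^ 3 + (C + 2) * Q ^ 3) * Q ^ 2 * y := by
          gcongr
          · linarith
          · exact le_rfl
      _ = _ := by ring
  have hA' : ∀ s ∈ Icc 0 T, ‖A' s‖ ≤ (2 * C + 9) * Q ^ 7 * w := fun s hs => by
    have := H.norm_le_of_rough hs (P := 2 * ((C + 4) * Q ^ 5)) (D := Q) (by positivity) hQ0.le
      hy0 hy1 hθ hθ1 hβ (A' s) fun t ht hts => by
        refine (H.norm_deriv_incr_le hA hs ht).trans ?_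
        have : |t - s| ^ (2 * γ) ≤ |t - s| ^ min (2 * γ) 1 :=
          Real.rpow_le_rpow_of_exponent_ge_of_imp (abs_nonneg _) hts (min_le_left _ _)
            (fun _ h0 => by linarith)
        rw [mul_assoc 2]
        gcongr
    refine this.trans ?_
    have h5 : Q ≤ Q ^ 5 := le_self_pow₀ hQ (by norm_num)
    calc _ ≤ (2 * ((C + 4) * Q ^ 5) + Q ^ 5) * Q ^ 2 * w := by
          gcongr
          exact le_rfl
      _ = _ := by ring
  have hB : ∀ s ∈ Icc 0 T, ‖B s‖ ≤ (4 * C + 16) * Q ^ 10 * w ^ driftExponent γ := fun s hs => by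
    -- The scale lemma is used with `θ = 1`. The coefficient `3 C + 15` collects 2 from `Z`, `C + 4`
    -- from `A` and `2 C + 9` from `A'`.
    have := le_mul_rpow_of_forall_scale (a := ‖B s‖) (P := (3 * C + 15) * Q ^ 9)
      (D := (C + 1) * Q ^ 3) (by positivity) (by positivity) hQ hw0 hw1 one_pos le_rfl
      (show 1 < min (3 * γ) (1 + γ) from lt_min (by linarith) (by linarith)) fun ε hε => by
        obtain ⟨t, ht, hts⟩ := exists_shift hε.1 (hε.2.trans H.inv_le) hs
        have e := H.mul_norm_drift_le hz hs ht
          (hts.le.trans (hε.2.trans (inv_le_one_of_one_le₀ hQ)))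
        rw [hts] at e
        rw [Real.rpow_one, mul_comm]
        refine e.trans ?_
        gcongr
        have a1 : z ≤ Q ^ 9 * w :=
          (hzy.trans hyw).trans (le_mul_of_one_le_left hw0.le (one_le_pow₀ hQ))
        have a2 : ‖A s‖ * Q ≤ (C + 4) * Q ^ 9 * w := by
          calc _ ≤ (C + 4) * Q ^ 5 * y * Q := mul_le_mul_of_nonneg_right (hA s hs) hQ0.le
            _ = (C + 4) * Q ^ 6 * y := by ring
            _ ≤ _ := by
              have := pQ (show 6 ≤ 9 by norm_num)
              gcongr
        have a3 : ‖A' s‖ * Q ^ 2 ≤ (2 * C + 9) * Q ^ 9 * w := by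
          calc _ ≤ (2 * C + 9) * Q ^ 7 * w * Q ^ 2 :=
                mul_le_mul_of_nonneg_right (hA' s hs) (by positivity)
            _ = _ := by ring
        linarith
    refine this.trans ?_
    calc _ ≤ ((3 * C + 15) * Q ^ 9 + (C + 1) * Q ^ 9) * Q * w ^ driftExponent γ := by
          unfold driftExponent
          gcongr ?_ * Q * _
          have := pQ (show 3 ≤ 9 by norm_num)
          gcongr
      _ = _ := by ring
  have hexp : z ^ norrisExponent γ θ = w ^ driftExponent γ := by
    rw [hw, hy, ← Real.rpow_mul hz0.le, ← Real.rpow_mul hz0.le]; rfl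
  rw [hexp]
  calc _ ≤ (C + 4) * Q ^ 10 * w ^ driftExponent γ
        + (4 * C + 16) * Q ^ 10 * w ^ driftExponent γ := by
        refine add_le_add ((hA s hs).trans ?_) (hB t ht)
        have := pQ (show 5 ≤ 10 by norm_num)
        have := hyw.trans hwd
        gcongr
    _ = _ := by rw [norrisConst]; ring

/-- The a priori bound, independent of `Z`: expand `A` around time 0. It has no constant depending
on `γ`, which makes the later interpolation effective. -/
theorem norm_add_norm_le (H : ControlledBy T γ θ Q X XX A A' B) {s t : ℝ} (hs : s ∈ Icc 0 T)
    (ht : t ∈ Icc 0 T) : ‖A s‖ + ‖B t‖ ≤ 4 * Q ^ 3 := by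
  have hγ := H.lt_exponent
  have hQ := H.one_le
  have h0 : (0 : ℝ) ∈ Icc 0 T := ⟨le_rfl, H.pos.le⟩
  have habs : |s - 0| ≤ Q := by
    rw [sub_zero, abs_of_nonneg hs.1]; exact hs.2.trans H.length_le
  have p1 : |s - 0| ^ γ ≤ Q := by
    refine (Real.rpow_le_rpow (abs_nonneg _) habs (by linarith)).trans ?_
    simpa using Real.rpow_le_rpow_of_exponent_le hQ H.exponent_le
  have p2 : |s - 0| ^ (2 * γ) ≤ Q ^ 2 := by
    refine (Real.rpow_le_rpow (abs_nonneg _) habs (by linarith)).trans ?_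
    rw [← Real.rpow_natCast]
    exact Real.rpow_le_rpow_of_exponent_le hQ (by push_cast; linarith [H.exponent_le])
  have hdec : A s = A 0 + A' 0 (incr X 0 s) + remainder X A A' 0 s := by simp [remainder, incr]
  have e1 : ‖A' 0 (incr X 0 s)‖ ≤ Q * (Q * Q) :=
    (A' 0).le_of_opNorm_le_of_le (H.deriv_sup 0 h0) ((H.path 0 h0 s hs).trans (by gcongr))
  have e2 : ‖remainder X A A' 0 s‖ ≤ Q * Q ^ 2 := (H.rem 0 h0 s hs).trans (by gcongr)
  have e3 : ‖A s‖ ≤ Q + Q * (Q * Q) + Q * Q ^ 2 := by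
    rw [hdec]
    exact (norm_add_le _ _).trans (add_le_add ((norm_add_le _ _).trans
      (add_le_add H.initial e1)) e2)
  have hQ1 : Q ≤ Q ^ 3 := le_self_pow₀ hQ (by norm_num)
  nlinarith [H.drift_sup t ht]

/-- The power to which the constant of Norris' lemma is raised in order to become uniform. -/
def damping (γ : ℝ) : ℝ := (norrisConst γ + 10)⁻¹

/-- Norris' lemma with a universal constant. -/
theorem norm_add_norm_le_mul_rpow (H : ControlledBy T γ θ Q X XX A A' B) (hθ : 0 < θ)
    (hθ1 : θ < 1) (hθγ : θ < 2 * γ) {z : ℝ} (hz0 : 0 < z)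
    (hz : ∀ t ∈ Icc 0 T, ‖integralPath X XX A A' B t‖ ≤ z) {s t : ℝ} (hs : s ∈ Icc 0 T)
    (ht : t ∈ Icc 0 T) :
    ‖A s‖ + ‖B t‖ ≤ 12 * Q ^ 4 * z ^ (norrisExponent γ θ * damping γ) := by
  have hγ := H.lt_exponent
  have hQ := H.one_le
  have hC := two_le_expansionConst hγ
  have hK : 20 ≤ norrisConst γ := by unfold norrisConst; linarith
  have hη := (integrandExponent_mem hγ hθ hθ1 hθγ).1
  have hδ := (driftExponent_mem hγ).1
  have hq : 0 < norrisExponent γ θ := by unfold norrisExponent; positivity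
  set K := norrisConst γ
  set q := norrisExponent γ θ
  set l := damping γ with hl
  have hl' : l = (K + 10)⁻¹ := rfl
  have hl0 : 0 < l := by rw [hl']; positivity
  have hl1 : l ≤ 1 := by rw [hl']; exact inv_le_one_of_one_le₀ (by linarith)
  have hKl : K * l ≤ 1 := by
    rw [hl', ← div_eq_mul_inv, div_le_one (by linarith)]; linarith
  have hl10 : 10 * l ≤ 1 := by
    rw [hl', ← div_eq_mul_inv, div_le_one (by linarith)]; linarith
  have b1 := H.norm_add_norm_le hs ht
  have b2 : ‖A s‖ + ‖B t‖ ≤ K * Q ^ 10 * z ^ q := by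
    rcases le_total z 1 with h | h
    -- For `z ≥ 1` the a priori bound already suffices, as `z ^ q ≥ 1`.
    · exact H.norm_add_norm_le_of_le_one hθ hθ1 hθγ hz0 h hz hs ht
    · have h1 : 1 ≤ z ^ q := Real.one_le_rpow h hq.le
      have h2 : Q ^ 3 ≤ Q ^ 10 := pow_le_pow_right₀ hQ (by norm_num)
      calc _ ≤ 4 * Q ^ 3 := b1
        _ ≤ K * Q ^ 10 := by gcongr; linarith
        _ ≤ _ := le_mul_of_one_le_right (by positivity) h1
  have hS : 0 ≤ ‖A s‖ + ‖B t‖ := by positivity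
  set S := ‖A s‖ + ‖B t‖
  -- With `l = 1 / (K + 10)`, the inequality `K ≤ exp K` gives `K ^ l ≤ e`, whatever `γ` is; the
  -- summand 10 in the denominator serves `(Q ^ 10) ^ l ≤ Q`.
  have hKexp : K ^ l ≤ 3 := by
    calc K ^ l ≤ (Real.exp K) ^ l :=
          Real.rpow_le_rpow (by linarith) (by linarith [Real.add_one_le_exp K]) hl0.le
      _ = Real.exp (K * l) := (Real.exp_mul _ _).symm
      _ ≤ Real.exp 1 := Real.exp_le_exp.2 hKl
      _ ≤ 3 := by linarith [Real.exp_one_lt_d9]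
  have hQl : (Q ^ 10) ^ l ≤ Q := by
    rw [← Real.rpow_natCast, ← Real.rpow_mul (by linarith)]
    simpa using Real.rpow_le_rpow_of_exponent_le hQ (show ((10 : ℕ) : ℝ) * l ≤ 1 by exact_mod_cast hl10)
  have h4Q : (4 * Q ^ 3) ^ (1 - l) ≤ 4 * Q ^ 3 := by
    have : 1 ≤ Q ^ 3 := one_le_pow₀ hQ
    simpa using Real.rpow_le_rpow_of_exponent_le (show 1 ≤ 4 * Q ^ 3 by linarith)
      (show 1 - l ≤ 1 by linarith)
  calc S = S ^ l * S ^ (1 - l) := by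
        rw [← Real.rpow_add_of_nonneg hS hl0.le (by linarith), add_sub_cancel, Real.rpow_one]
    _ ≤ (K * Q ^ 10 * z ^ q) ^ l * (4 * Q ^ 3) ^ (1 - l) := by
        gcongr
    _ = K ^ l * (Q ^ 10) ^ l * z ^ (q * l) * (4 * Q ^ 3) ^ (1 - l) := by
        rw [Real.mul_rpow (by positivity) (by positivity), Real.mul_rpow (by positivity)
          (by positivity), Real.rpow_mul hz0.le]
    _ ≤ 3 * Q * z ^ (q * l) * (4 * Q ^ 3) := by gcongr
    _ = _ := by ring

end ControlledBy

/-! ### From suprema to pointwise bounds. -/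

section Norms

variable {F : Type*} [NormedAddCommGroup F]

theorem norm_le_supNorm {T : ℝ} {f : ℝ → F} (hf : BddAbove ((fun t => ‖f t‖) '' Icc 0 T)) {t : ℝ}
    (ht : t ∈ Icc 0 T) : ‖f t‖ ≤ supNorm T f :=
  le_csSup hf (mem_image_of_mem _ ht)

theorem bddAbove_norm_image {T : ℝ} {f : ℝ → F} (hf : ContinuousOn f (Icc 0 T)) :
    BddAbove ((fun t => ‖f t‖) '' Icc 0 T) :=
  isCompact_Icc.bddAbove_image hf.norm

theorem supNorm_nonneg (T : ℝ) (f : ℝ → F) : 0 ≤ supNorm T f :=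
  Real.sSup_nonneg (by rintro _ ⟨t, -, rfl⟩; exact norm_nonneg _)

theorem holderSeminorm_nonneg (T α : ℝ) (R : ℝ → ℝ → F) : 0 ≤ holderSeminorm T α R :=
  Real.sSup_nonneg (by rintro _ ⟨s, -, t, -, -, rfl⟩; positivity)

theorem FiniteHolder.norm_le {T α : ℝ} {R : ℝ → ℝ → F} (hR : FiniteHolder T α R)
    (hdiag : ∀ s ∈ Icc 0 T, R s s = 0) {Q : ℝ} (hQ : holderSeminorm T α R ≤ Q) {s t : ℝ}
    (hs : s ∈ Icc 0 T) (ht : t ∈ Icc 0 T) : ‖R s t‖ ≤ Q * |t - s| ^ α := by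
  have hQ0 := (holderSeminorm_nonneg T α R).trans hQ
  rcases eq_or_ne s t with rfl | hst
  · rw [hdiag s hs, norm_zero]; positivity
  · have hpos : 0 < |t - s| ^ α := Real.rpow_pos_of_pos (abs_pos.2 (sub_ne_zero.2 hst.symm)) _
    rw [← div_le_iff₀ hpos]
    exact (le_csSup hR ⟨s, hs, t, ht, hst, rfl⟩).trans hQ

theorem supNorm_add_supNorm_le {G : Type*} [NormedAddCommGroup G] {T : ℝ} (hT : 0 ≤ T) {f : ℝ → F}
    {g : ℝ → G} {c : ℝ} (h : ∀ s ∈ Icc 0 T, ∀ t ∈ Icc 0 T, ‖f s‖ + ‖g t‖ ≤ c) :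
    supNorm T f + supNorm T g ≤ c := by
  have hne : (Icc 0 T).Nonempty := ⟨0, le_rfl, hT⟩
  have h1 : ∀ t ∈ Icc 0 T, supNorm T f ≤ c - ‖g t‖ := fun t ht =>
    csSup_le (hne.image _) (by rintro _ ⟨s, hs, rfl⟩; exact le_sub_iff_add_le.2 (h s hs t ht))
  have h2 : supNorm T g ≤ c - supNorm T f :=
    csSup_le (hne.image _) (by rintro _ ⟨t, ht, rfl⟩; dsimp only; linarith [h1 t ht])
  linarith

end Norms

section Roughness

variable {n : ℕ} {T γ θ : ℝ} {X : ℝ → Vec n}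

theorem RoughWith.mono {L L' : ℝ} (h : RoughWith T θ X L) (hL : L' ≤ L) : RoughWith T θ X L' := by
  intro s hs ε hε φ hφ
  obtain ⟨t, ht, h1, h2, h3⟩ := h s hs ε hε φ hφ
  have : 0 ≤ ε ^ θ := Real.rpow_nonneg hε.1.le _
  exact ⟨t, ht, h1, h2, (mul_le_mul_of_nonneg_right hL this).trans_lt h3⟩

/-- Roughness from below against Hölder regularity from above, tested on one coordinate. At `ε = T /
2` it shows that `roughModulus` is a genuine supremum; as `ε → 0` it forces `γ ≤ θ`. -/
theorem RoughWith.mul_rpow_le {L : ℝ} (h : RoughWith T θ X L) (hT : 0 ≤ T) (hn : 1 ≤ n)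
    (hγ : 0 ≤ γ) (hX : FiniteHolder T γ (incr X)) {ε : ℝ} (hε : ε ∈ Ioc 0 (T / 2)) :
    L * ε ^ θ ≤ holderSeminorm T γ (incr X) * ε ^ γ := by
  have h0 : (0 : ℝ) ∈ Icc 0 T := ⟨le_rfl, hT⟩
  have hφ : ‖(EuclideanSpace.single ⟨0, hn⟩ 1 : Vec n)‖ = 1 := by simp
  obtain ⟨t, ht, -, h2, h3⟩ := h 0 h0 ε hε _ hφ
  have e1 := abs_real_inner_le_norm (EuclideanSpace.single ⟨0, hn⟩ 1 : Vec n) (incr X 0 t)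
  rw [hφ, one_mul] at e1
  have e2 := hX.norm_le (fun s _ => by simp [incr]) le_rfl h0 ht
  have hs := holderSeminorm_nonneg T γ (incr X)
  calc _ ≤ _ := h3.le
    _ ≤ _ := e1.trans e2
    _ ≤ _ := by gcongr

theorem bddAbove_roughWith (hT : 0 < T) (hn : 1 ≤ n) (hγ : 0 ≤ γ)
    (hX : FiniteHolder T γ (incr X)) : BddAbove {L : ℝ | 0 < L ∧ RoughWith T θ X L} := by
  have hpos : 0 < (T / 2) ^ θ := by positivity
  refine ⟨holderSeminorm T γ (incr X) * (T / 2) ^ γ / (T / 2) ^ θ, fun L hL => ?_⟩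
  rw [le_div_iff₀ hpos]
  exact hL.2.mul_rpow_le hT.le hn hγ hX ⟨by linarith, le_rfl⟩

/-- A `θ`-Hölder rough path is at most `θ`-Hölder regular. -/
theorem IsHolderRough.exponent_le (h : IsHolderRough T θ X) (hT : 0 < T) (hn : 1 ≤ n)
    (hγ : 0 ≤ γ) (hX : FiniteHolder T γ (incr X)) : γ ≤ θ := by
  obtain ⟨L, hL, hrough⟩ := h
  by_contra! hlt
  have hlim : Tendsto (fun ε : ℝ => holderSeminorm T γ (incr X) * ε ^ (γ - θ)) (𝓝[>] 0)
      (𝓝 (holderSeminorm T γ (incr X) * 0 ^ (γ - θ))) :=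
    ((Real.continuousAt_rpow_const 0 (γ - θ) (Or.inr (by linarith))).tendsto.const_mul _).mono_left
      nhdsWithin_le_nhds
  rw [Real.zero_rpow (by linarith), mul_zero] at hlim
  refine absurd (ge_of_tendsto (b := L) hlim ?_) (not_le.2 hL)
  filter_upwards [Ioc_mem_nhdsGT (show 0 < T / 2 by linarith)] with ε hε
  have := hrough.mul_rpow_le hT.le hn hγ hX hε
  have hpos : 0 < ε ^ θ := Real.rpow_pos_of_pos hε.1 _
  rw [Real.rpow_sub hε.1, ← mul_div_assoc, le_div_iff₀ hpos]
  exact this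

/-- The supremum itself need not be admissible, so only strictly smaller constants are used; the
summand 1 in `norrisR` supplies the strictness. -/
theorem IsHolderRough.roughWith_of_lt (h : IsHolderRough T θ X) {L : ℝ}
    (hL : L < roughModulus T θ X) : RoughWith T θ X L := by
  obtain ⟨L₀, hL₀⟩ := h
  obtain ⟨L', hL', hlt⟩ := exists_lt_of_lt_csSup ⟨L₀, hL₀⟩ hL
  exact hL'.2.mono hlt.le

theorem IsHolderRough.roughModulus_pos (h : IsHolderRough T θ X) (hT : 0 < T) (hn : 1 ≤ n)
    (hγ : 0 ≤ γ) (hX : FiniteHolder T γ (incr X)) : 0 < roughModulus T θ X := by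
  obtain ⟨L, hL⟩ := h
  exact hL.1.trans_le (le_csSup (bddAbove_roughWith hT hn hγ hX) hL)

end Roughness

/-! ### Reduction to the single parameter `Q` and conclusion. -/

/-- The factor by which the interval length and the dimension enter the estimates. -/
def sizeFactor (T : ℝ) (n : ℕ) : ℝ := 1 + T + 2 / T + (n : ℝ) ^ 2

theorem one_le_norrisR {n m : ℕ} {T γ θ : ℝ} {X : ℝ → Vec n} {XX : ℝ → ℝ → Area n}
    {A : ℝ → Vec n →L[ℝ] Vec m} {A' : ℝ → Vec n →L[ℝ] Vec n →L[ℝ] Vec m} {B : ℝ → Vec m}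
    (hL : 0 < roughModulus T θ X) : 1 ≤ norrisR T γ θ X XX A A' B := by
  have h1 := inv_pos.2 hL
  have h2 := holderSeminorm_nonneg T γ (incr X)
  have h3 := holderSeminorm_nonneg T (2 * γ) XX
  have h4 := norm_nonneg (A 0)
  have h5 := supNorm_nonneg T A'
  have h6 := holderSeminorm_nonneg T γ (incr A')
  have h7 := holderSeminorm_nonneg T (2 * γ) (remainder X A A')
  have h8 := supNorm_nonneg T B
  have h9 := holderSeminorm_nonneg T γ (incr B)
  unfold norrisR roughPathNorm controlledNorm holderNorm
  linarith

theorem controlledBy_of_isControlled {n m : ℕ} {T γ θ : ℝ} {X : ℝ → Vec n} {XX : ℝ → ℝ → Area n}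
    {A : ℝ → Vec n →L[ℝ] Vec m} {A' : ℝ → Vec n →L[ℝ] Vec n →L[ℝ] Vec m} {B : ℝ → Vec m}
    (hT : 0 < T) (hn : 1 ≤ n) (hγ : 1 / 3 < γ) (hθ1 : θ < 1)
    (hX : IsRoughPath T γ X XX) (hXr : IsHolderRough T θ X) (hA : IsControlled T γ X A A')
    (hB : IsHolderPath T γ B) :
    ControlledBy T γ θ (sizeFactor T n * norrisR T γ θ X XX A A' B) X XX A A' B := by
  have hγ0 : 0 ≤ γ := by linarith
  have hL := hXr.roughModulus_pos hT hn hγ0 hX.finite_path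
  have hR1 : 1 ≤ norrisR T γ θ X XX A A' B := one_le_norrisR hL
  have h1 := inv_pos.2 hL
  have h2 := holderSeminorm_nonneg T γ (incr X)
  have h3 := holderSeminorm_nonneg T (2 * γ) XX
  have h4 := norm_nonneg (A 0)
  have h5 := supNorm_nonneg T A'
  have h6 := holderSeminorm_nonneg T γ (incr A')
  have h7 := holderSeminorm_nonneg T (2 * γ) (remainder X A A')
  have h8 := supNorm_nonneg T B
  have h9 := holderSeminorm_nonneg T γ (incr B)
  have hR : norrisR T γ θ X XX A A' B = 1 + (roughModulus T θ X)⁻¹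
      + (holderSeminorm T γ (incr X) + holderSeminorm T (2 * γ) XX)
      + (‖A 0‖ + (supNorm T A' + holderSeminorm T γ (incr A'))
        + holderSeminorm T (2 * γ) (remainder X A A'))
      + (supNorm T B + holderSeminorm T γ (incr B)) := rfl
  set R := norrisR T γ θ X XX A A' B
  have hκ0 : 0 < 2 / T := by positivity
  have hκn : 0 ≤ (n : ℝ) ^ 2 := by positivity
  have hκ : sizeFactor T n = 1 + T + 2 / T + (n : ℝ) ^ 2 := rfl
  have hκ1 : 1 ≤ sizeFactor T n := by linarith
  set κ := sizeFactor T n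
  have hRQ : R ≤ κ * R := le_mul_of_one_le_left (by linarith) hκ1
  have hκQ : κ ≤ κ * R := le_mul_of_one_le_right (by linarith) hR1
  set Q := κ * R
  have hQ1 : 1 ≤ Q := hκ1.trans hκQ
  exact
    { pos := hT
      lt_exponent := hγ
      -- No upper bound on `γ` is assumed; roughness supplies `γ ≤ θ < 1`.
      exponent_le := (hXr.exponent_le hT hn hγ0 hX.finite_path).trans hθ1.le
      one_le := hQ1
      length_le := by linarith
      inv_le := by
        rw [inv_le_comm₀ (by linarith) (by positivity), inv_div]; linarith
      dim_le := by linarith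
      path := fun s hs t ht => hX.finite_path.norm_le (fun s _ => by simp [incr])
        (by linarith) hs ht
      area := fun s hs t ht => hX.finite_area.norm_le hX.area_diag (by linarith) hs ht
      chen := hX.chen
      rough := hXr.roughWith_of_lt (inv_lt_of_inv_lt₀ hL (by linarith))
      initial := by linarith
      deriv_sup := fun t ht =>
        (norm_le_supNorm (bddAbove_norm_image hA.deriv.continuousOn) ht).trans (by linarith)
      deriv_holder := fun s hs t ht => hA.deriv.finite.norm_le (fun s _ => by simp [incr])
        (by linarith) hs ht
      rem := fun s hs t ht => hA.finite_remainder.norm_le (fun s _ => by simp [remainder, incr])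
        (by linarith) hs ht
      drift_cont := hB.continuousOn
      drift_sup := fun t ht =>
        (norm_le_supNorm (bddAbove_norm_image hB.continuousOn) ht).trans (by linarith)
      drift_holder := fun s hs t ht => hB.finite.norm_le (fun s _ => by simp [incr])
        (by linarith) hs ht }

end NorrisRP
end

open NorrisRP in
theorem theorem3p3 :
    -- the exponent `r` depends on `γ` and `θ` only
    ∃ r : ℝ → ℝ → ℝ,
      (∀ γ θ : ℝ, 1 / 3 < γ → 0 < θ → θ < 1 → θ < 2 * γ → 0 < r γ θ) ∧
      -- the constant `M` depends on `T`, `m`, `n` only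
      ∀ (T : ℝ) (m n : ℕ), 0 < T → 1 ≤ n → ∃ M : ℝ, 0 < M ∧
        ∀ γ θ : ℝ, 1 / 3 < γ → 0 < θ → θ < 1 → θ < 2 * γ →
        ∀ (X : ℝ → Vec n) (XX : ℝ → ℝ → Area n) (A : ℝ → Vec n →L[ℝ] Vec m)
          (A' : ℝ → Vec n →L[ℝ] Vec n →L[ℝ] Vec m) (B : ℝ → Vec m),
          IsRoughPath T γ X XX → IsHolderRough T θ X →
          IsControlled T γ X A A' → IsHolderPath T γ B →
          -- the compensated Riemann sums converge to the rough integral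
          (∀ t ∈ Set.Icc 0 T, Filter.Tendsto (fun P => riemannSum X XX A A' P) (meshFilter 0 t)
            (nhds (roughIntegral X XX A A' t))) ∧
          supNorm T A + supNorm T B ≤ M * norrisR T γ θ X XX A A' B ^ 6 *
            supNorm T (integralPath X XX A A' B) ^ r γ θ ∧
          (0 < supNorm T (integralPath X XX A A' B) →
            supNorm T A + supNorm T B < M * norrisR T γ θ X XX A A' B ^ 6 *
              supNorm T (integralPath X XX A A' B) ^ r γ θ) := by
  have hr : ∀ γ θ : ℝ, 1 / 3 < γ → 0 < θ → θ < 1 → θ < 2 * γ →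
      0 < ControlledBy.norrisExponent γ θ * ControlledBy.damping γ := by
    intro γ θ hγ hθ hθ1 hθγ
    have h1 := (ControlledBy.integrandExponent_mem hγ hθ hθ1 hθγ).1
    have h2 := (ControlledBy.driftExponent_mem hγ).1
    have h3 := ControlledBy.two_le_expansionConst hγ
    unfold ControlledBy.norrisExponent ControlledBy.damping ControlledBy.norrisConst
    positivity
  refine ⟨fun γ θ => ControlledBy.norrisExponent γ θ * ControlledBy.damping γ, hr,
    fun T m n hT hn => ?_⟩
  have hκ : 0 < sizeFactor T n := by unfold sizeFactor; positivity
  -- Twice the constant 12 that is proved, which gives the strict inequality when the norm of `Z` is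
  -- positive.
  refine ⟨24 * sizeFactor T n ^ 4, by positivity,
    fun γ θ hγ hθ hθ1 hθγ X XX A A' B hX hXr hA hB => ?_⟩
  have H := controlledBy_of_isControlled hT hn hγ hθ1 hX hXr hA hB
  have hR1 : 1 ≤ norrisR T γ θ X XX A A' B :=
    one_le_norrisR (hXr.roughModulus_pos hT hn (by linarith) hX.finite_path)
  have hr0 := hr γ θ hγ hθ hθ1 hθγ
  set r := ControlledBy.norrisExponent γ θ * ControlledBy.damping γ
  set R := norrisR T γ θ X XX A A' B
  set Z := integralPath X XX A A' B
  have hZ0 := supNorm_nonneg T Z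
  have hle : supNorm T A + supNorm T B
      ≤ 12 * (sizeFactor T n * R) ^ 4 * supNorm T Z ^ r := by
    -- The estimate needs `z > 0`, so it is applied to `z` above the norm of `Z` and `z` decreases
    -- to it; this covers the case where `Z` vanishes on `[0, T]`.
    have hlim : Tendsto (fun z : ℝ => 12 * (sizeFactor T n * R) ^ 4 * z ^ r)
        (𝓝[>] (supNorm T Z)) (𝓝 (12 * (sizeFactor T n * R) ^ 4 * supNorm T Z ^ r)) :=
      ((Real.continuousAt_rpow_const _ r (Or.inr hr0.le)).tendsto.const_mul _).mono_left
        nhdsWithin_le_nhds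
    refine ge_of_tendsto hlim ?_
    filter_upwards [self_mem_nhdsWithin] with z hz
    have hz' : supNorm T Z < z := hz
    exact supNorm_add_supNorm_le hT.le fun s hs t ht =>
      H.norm_add_norm_le_mul_rpow hθ hθ1 hθγ (hZ0.trans_lt hz')
        (fun t ht => (norm_le_supNorm H.bddAbove_integralPath ht).trans hz'.le) hs ht
  have hR4 : R ^ 4 ≤ R ^ 6 := pow_le_pow_right₀ hR1 (by norm_num)
  have hle2 : supNorm T A + supNorm T B ≤ 12 * sizeFactor T n ^ 4 * R ^ 6 * supNorm T Z ^ r := by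
    refine hle.trans ?_
    rw [mul_pow, ← mul_assoc]
    gcongr
  refine ⟨fun t ht => H.tendsto_riemannSum ht, ?_, fun hZ => ?_⟩
  · have : 0 ≤ 12 * sizeFactor T n ^ 4 * R ^ 6 * supNorm T Z ^ r := by positivity
    linarith
  · have : 0 < 12 * sizeFactor T n ^ 4 * R ^ 6 * supNorm T Z ^ r := by positivity
    linarith
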